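/- Theorem (universal cover of $V$). All triangles below are Euclidean equilateral triangles of side $1$, and all lozenges are Euclidean rhombi of side $1$ with angles $\pi/3$ (acute) and $2\pi/3$ (obtuse). Let $S$ be the compact complex with three vertices $0,1,2$, twelve oriented edges $x_k\colon 0\to 1$, $y_k\colon 1\to 2$, $z_k\colon 2\to 0$ $(k\in\{a,b,c,d\})$, four triangles with boundary words $x_ky_kz_k$ $(k\in\{a,b,c,d\})$, and three lozenges $x,y,z$ with boundary words, read from an acute corner, $$x_cx_b^{-1}x_dx_a^{-1},\qquad y_by_c^{-1}y_dy_a^{-1},\qquad z_cz_b^{-1}z_dz_a^{-1}.$$ Let $V$ be the compact complex obtained from $S$ by gluing three further lozenges $x',y',z'$ along the boundary words, read from an acute corner, $$x_c^{-1}x_bx_d^{-1}x_a,\qquad y_b^{-1}y_cy_d^{-1}y_a,\qquad z_b^{-1}z_cz_d^{-1}z_a.$$ Let $G=\langle \sigma_1,\sigma_2,\sigma_3\mid \sigma_1\sigma_3=\sigma_3\sigma_1,\ \sigma_1\sigma_2\sigma_1=\sigma_2\sigma_1\sigma_2,\ \sigma_2\sigma_3\sigma_2=\sigma_3\sigma_2\sigma_3,\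 (\sigma_1\sigma_2\sigma_3)^4=1\rangle$ be the four-strand braid group modulo its center, and let $\delta=\sigma_1\sigma_2\sigma_3$. The Brady complex $X$ is the complex whose vertices are the cosets $[g]=g\langle\delta\rangle$, $g \in G$; whose edges are the elements $g$ of $G$, the edge $g$ going from $[g]$ to $[g\sigma_1]$; whose triangles are indexed by $G/\langle\sigma_1\delta\rangle$, the triangle of $g$ being bounded by the edges $g$, $g\sigma_1\delta$, $g(\sigma_1\delta)^2$, with vertices $[g],[g\sigma_1],[g\sigma_1\sigma_2]$; and whose lozenges are indexed by $G/\langle\delta^2\rangle$, the lozenge of $g$ being bounded by the path $(g\sigma_1\delta^2)(g\sigma_3)^{-1}(g\delta^2)^{-1}(g)$ of edges through its corners $[g\sigma_1]$ (acute), $[g\sigma_1\sigma_3]$ (obtuse), $[g\sigma_3]$ (acute), $[g]$ (obtuse), where $e^{-1}$ denotes an edge traversed backwards. Then the universal cover of $V$ is the Brady complex $X$: the space $X$ is simply connected, and there is a surjective covering map $p\colon X\to V$ which carries every closed vertex, edge, triangle and lozenge of $X$ isometrically (with respect to its Euclidean model) onto a closed cell of $V$ of the same type. -/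

import Mathlib

/-! Two-dimensional complexes built from equilateral triangles and lozenges of side `1`. -/

/-- The combinatorial data of a complex of triangles and lozenges: vertices, edges (each with a
reference orientation from `src` to `tgt`), triangles, and lozenges, with their boundaries.
The pair `(e, true)` is the edge `e` traversed from `src e` to `tgt e`, the pair `(e, false)` is
`e` traversed backwards. Side `i` of a face runs from its corner `i` to its corner `i + 1`
(cyclically). Corners `0` and `2` of a lozenge are the acute ones (angle `π / 3`), corners `1`
and `3` the obtuse ones (angle `2 π / 3`). -/
structure LozengeComplex where
  Vert : Type
  Edge : Type
  Tri : Type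
  Loz : Type
  src : Edge → Vert
  tgt : Edge → Vert
  triSide : Tri → Fin 3 → Edge × Bool
  lozSide : Loz → Fin 4 → Edge × Bool
  /-- each side of a triangle starts where the preceding one ends -/
  tri_closed : ∀ t i,
    (bif (triSide t (i + 1)).2 then src (triSide t (i + 1)).1 else tgt (triSide t (i + 1)).1) =
      (bif (triSide t i).2 then tgt (triSide t i).1 else src (triSide t i).1)
  /-- each side of a lozenge starts where the preceding one ends -/
  loz_closed : ∀ l i,
    (bif (lozSide l (i + 1)).2 then src (lozSide l (i + 1)).1 else tgt (lozSide l (i + 1)).1) =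
      (bif (lozSide l i).2 then tgt (lozSide l i).1 else src (lozSide l i).1)

namespace LozengeComplex

/-- The closed cells of a complex. -/
inductive Cell (K : LozengeComplex) : Type
  | vert (v : K.Vert) : Cell K
  | edge (e : K.Edge) : Cell K
  | tri (t : K.Tri) : Cell K
  | loz (l : K.Loz) : Cell K

/-- The primitive sixth root of unity `exp (i π / 3)`. -/
noncomputable def omega : ℂ := ⟨1 / 2, √3 / 2⟩

/-- The corners of the model equilateral triangle. -/
noncomputable def triCorner : Fin 3 → ℂ := ![0, 1, omega]

/-- The corners of the model lozenge. -/
noncomputable def lozCorner : Fin 4 → ℂ := ![0, 1, 1 + omega, omega]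

variable {K : LozengeComplex}

/-- The model of a closed cell, a convex subset of the Euclidean plane `ℂ`: a point, a segment of
length `1`, an equilateral triangle of side `1`, or a lozenge of side `1`. -/
noncomputable def Cell.shape : K.Cell → Set ℂ
  | .vert _ => {0}
  | .edge _ => segment ℝ 0 1
  | .tri _ => convexHull ℝ (Set.range triCorner)
  | .loz _ => convexHull ℝ (Set.range lozCorner)

variable (K)

/-- The disjoint union of the models of all closed cells, with the disjoint union topology. -/
abbrev PreRealization : Type := Σ c : K.Cell, c.shape

/-- The gluing: the two ends of each edge are glued to its two vertices, and each side of each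
face is glued isometrically to the corresponding edge, in the direction of travel. -/
inductive Glue : K.PreRealization → K.PreRealization → Prop
  | src (e : K.Edge) (x : (Cell.edge e : K.Cell).shape) (y : (Cell.vert (K.src e)).shape)
      (hx : (x : ℂ) = 0) : Glue ⟨.edge e, x⟩ ⟨.vert (K.src e), y⟩
  | tgt (e : K.Edge) (x : (Cell.edge e : K.Cell).shape) (y : (Cell.vert (K.tgt e)).shape)
      (hx : (x : ℂ) = 1) : Glue ⟨.edge e, x⟩ ⟨.vert (K.tgt e), y⟩
  | tri (t : K.Tri) (i : Fin 3) (s : ℝ) (x : (Cell.tri t : K.Cell).shape)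
      (y : (Cell.edge (K.triSide t i).1 : K.Cell).shape)
      (hx : (x : ℂ) = AffineMap.lineMap (triCorner i) (triCorner (i + 1)) s)
      (hy : (y : ℂ) = bif (K.triSide t i).2 then (s : ℂ) else 1 - (s : ℂ)) :
      Glue ⟨.tri t, x⟩ ⟨.edge (K.triSide t i).1, y⟩
  | loz (l : K.Loz) (i : Fin 4) (s : ℝ) (x : (Cell.loz l : K.Cell).shape)
      (y : (Cell.edge (K.lozSide l i).1 : K.Cell).shape)
      (hx : (x : ℂ) = AffineMap.lineMap (lozCorner i) (lozCorner (i + 1)) s)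
      (hy : (y : ℂ) = bif (K.lozSide l i).2 then (s : ℂ) else 1 - (s : ℂ)) :
      Glue ⟨.loz l, x⟩ ⟨.edge (K.lozSide l i).1, y⟩

/-- The topological space underlying a complex: the disjoint union of its closed cells modulo the
equivalence relation generated by the gluing, with the quotient topology. -/
def Realization : Type := Quot K.Glue

instance : TopologicalSpace K.Realization := inferInstanceAs (TopologicalSpace (Quot K.Glue))

variable {K}

/-- The characteristic map of a closed cell. -/
def charMap (c : K.Cell) (x : c.shape) : K.Realization := Quot.mk K.Glue ⟨c, x⟩

/-- A map between complexes which carries every closed cell isometrically onto a closed cell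
(hence vertices to vertices, edges to edges, triangles to triangles, lozenges to lozenges). -/
def IsCellwiseIsometric {K L : LozengeComplex} (p : K.Realization → L.Realization) : Prop :=
  ∀ c : K.Cell, ∃ (d : L.Cell) (φ : c.shape ≃ᵢ d.shape),
    ∀ x, p (charMap c x) = charMap d (φ x)

/-- Attach further lozenges to a complex, along closed edge paths of length four. -/
def attachLozenges (K : LozengeComplex) (Loz' : Type) (side : Loz' → Fin 4 → K.Edge × Bool)
    (closed : ∀ l i,
      (bif (side l (i + 1)).2 then K.src (side l (i + 1)).1 else K.tgt (side l (i + 1)).1) =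
        (bif (side l i).2 then K.tgt (side l i).1 else K.src (side l i).1)) :
    LozengeComplex where
  Vert := K.Vert
  Edge := K.Edge
  Tri := K.Tri
  Loz := K.Loz ⊕ Loz'
  src := K.src
  tgt := K.tgt
  triSide := K.triSide
  lozSide := Sum.elim K.lozSide side
  tri_closed := K.tri_closed
  loz_closed := by
    rintro (l | l) i
    · exact K.loz_closed l i
    · exact closed l i

end LozengeComplex

/-- A universal covering: a surjective covering map with simply connected total space. -/
def IsUniversalCover {E B : Type*} [TopologicalSpace E] [TopologicalSpace B] (p : E → B) : Prop :=
  IsCoveringMap p ∧ Function.Surjective p ∧ SimplyConnectedSpace E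

/-! The surface `S` and the complex `V`. -/

namespace HamiltonianSurface

/-- The names of the three lozenges (and of the three sides of each triangle). -/
inductive Letter : Type
  | x | y | z

/-- The names of the four triangles. -/
inductive Index : Type
  | a | b | c | d

/-- The twelve edges `x_a, …, z_d`. -/
abbrev Edge : Type := Letter × Index

/-- The initial vertex of an edge depends only on its letter. -/
def src : Edge → Fin 3
  | (.x, _) => 0
  | (.y, _) => 1
  | (.z, _) => 2

/-- The terminal vertex of an edge depends only on its letter. -/
def tgt : Edge → Fin 3
  | (.x, _) => 1
  | (.y, _) => 2
  | (.z, _) => 0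

/-- Triangle `k` has boundary `x_k y_k z_k`. -/
def triSide (k : Index) : Fin 3 → Edge × Bool :=
  ![((.x, k), true), ((.y, k), true), ((.z, k), true)]

/-- The boundaries `x_c x_b⁻¹ x_d x_a⁻¹`, `y_b y_c⁻¹ y_d y_a⁻¹`, `z_c z_b⁻¹ z_d z_a⁻¹` of the
lozenges `x`, `y`, `z`, read from an acute corner. -/
def lozSide : Letter → Fin 4 → Edge × Bool
  | .x => ![((.x, .c), true), ((.x, .b), false), ((.x, .d), true), ((.x, .a), false)]
  | .y => ![((.y, .b), true), ((.y, .c), false), ((.y, .d), true), ((.y, .a), false)]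
  | .z => ![((.z, .c), true), ((.z, .b), false), ((.z, .d), true), ((.z, .a), false)]

/-- The boundaries `x_c⁻¹ x_b x_d⁻¹ x_a`, `y_b⁻¹ y_c y_d⁻¹ y_a`, `z_b⁻¹ z_c z_d⁻¹ z_a` of the
filling lozenges `x'`, `y'`, `z'`, read from an acute corner. -/
def fillSide : Letter → Fin 4 → Edge × Bool
  | .x => ![((.x, .c), false), ((.x, .b), true), ((.x, .d), false), ((.x, .a), true)]
  | .y => ![((.y, .b), false), ((.y, .c), true), ((.y, .d), false), ((.y, .a), true)]
  | .z => ![((.z, .b), false), ((.z, .c), true), ((.z, .d), false), ((.z, .a), true)]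

/-- The surface `S`, made of four triangles and three lozenges. -/
def surfaceS : LozengeComplex where
  Vert := Fin 3
  Edge := Edge
  Tri := Index
  Loz := Letter
  src := src
  tgt := tgt
  triSide := triSide
  lozSide := lozSide
  tri_closed := by intro t i; fin_cases i <;> rfl
  loz_closed := by intro l i; cases l <;> fin_cases i <;> rfl

/-- The complex `V`, obtained from `S` by gluing the lozenges `x'`, `y'`, `z'`. -/
def complexV : LozengeComplex :=
  surfaceS.attachLozenges Letter fillSide
    (by intro l i; cases l <;> fin_cases i <;> rfl)

end HamiltonianSurface

/-! The Brady complex `X`. -/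

namespace Brady

open FreeGroup in
/-- The relators `σ₁σ₃ = σ₃σ₁`, `σ₁σ₂σ₁ = σ₂σ₁σ₂`, `σ₂σ₃σ₂ = σ₃σ₂σ₃`, `(σ₁σ₂σ₃)⁴ = 1`. -/
def relators : Set (FreeGroup (Fin 3)) :=
  {of 0 * of 2 * (of 2 * of 0)⁻¹,
   of 0 * of 1 * of 0 * (of 1 * of 0 * of 1)⁻¹,
   of 1 * of 2 * of 1 * (of 2 * of 1 * of 2)⁻¹,
   (of 0 * of 1 * of 2) ^ 4}

/-- The quotient of the braid group on four strands by its center, which is generated by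
`(σ₁σ₂σ₃)⁴`. (It is isomorphic to a subgroup of index two in the automorphism group of the free
group of rank two.) -/
abbrev G : Type := PresentedGroup relators

/-- A standard generator. -/
def σ₁ : G := PresentedGroup.of 0

/-- A standard generator. -/
def σ₂ : G := PresentedGroup.of 1

/-- A standard generator. -/
def σ₃ : G := PresentedGroup.of 2

/-- The (dual) Garside element `δ = σ₁σ₂σ₃`. -/
def δ : G := σ₁ * σ₂ * σ₃

theorem comm13 : σ₁ * σ₃ = σ₃ * σ₁ := by
  have h := PresentedGroup.one_of_mem (rels := relators)
    (x := FreeGroup.of 0 * FreeGroup.of 2 * (FreeGroup.of 2 * FreeGroup.of 0)⁻¹)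
    (by simp [relators])
  rw [map_mul, map_inv, mul_inv_eq_one] at h
  simp only [map_mul, map_pow] at h
  exact h

theorem braid12 : σ₁ * σ₂ * σ₁ = σ₂ * σ₁ * σ₂ := by
  have h := PresentedGroup.one_of_mem (rels := relators)
    (x := FreeGroup.of 0 * FreeGroup.of 1 * FreeGroup.of 0 *
      (FreeGroup.of 1 * FreeGroup.of 0 * FreeGroup.of 1)⁻¹)
    (by simp [relators])
  rw [map_mul, map_inv, mul_inv_eq_one] at h
  simp only [map_mul, map_pow] at h
  exact h

theorem braid23 : σ₂ * σ₃ * σ₂ = σ₃ * σ₂ * σ₃ := by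
  have h := PresentedGroup.one_of_mem (rels := relators)
    (x := FreeGroup.of 1 * FreeGroup.of 2 * FreeGroup.of 1 *
      (FreeGroup.of 2 * FreeGroup.of 1 * FreeGroup.of 2)⁻¹)
    (by simp [relators])
  rw [map_mul, map_inv, mul_inv_eq_one] at h
  simp only [map_mul, map_pow] at h
  exact h

theorem delta_pow_four : δ ^ 4 = 1 := by
  have h := PresentedGroup.one_of_mem (rels := relators)
    (x := (FreeGroup.of 0 * FreeGroup.of 1 * FreeGroup.of 2) ^ 4)
    (by simp [relators])
  simp only [map_mul, map_pow] at h
  exact h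

theorem delta_mul_σ₁ : δ * σ₁ = σ₂ * δ := by
  calc δ * σ₁ = σ₁ * σ₂ * (σ₃ * σ₁) := by simp only [δ, mul_assoc]
    _ = (σ₁ * σ₂ * σ₁) * σ₃ := by rw [← comm13]; simp only [mul_assoc]
    _ = σ₂ * δ := by rw [braid12]; simp only [δ, mul_assoc]

theorem delta_mul_σ₂ : δ * σ₂ = σ₃ * δ := by
  calc δ * σ₂ = σ₁ * (σ₂ * σ₃ * σ₂) := by simp only [δ, mul_assoc]
    _ = (σ₁ * σ₃) * σ₂ * σ₃ := by rw [braid23]; simp only [mul_assoc]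
    _ = σ₃ * δ := by rw [comm13]; simp only [δ, mul_assoc]

theorem delta_sq_mul_σ₁ : δ ^ 2 * σ₁ = σ₃ * δ ^ 2 := by
  rw [pow_two, mul_assoc, delta_mul_σ₁, ← mul_assoc, delta_mul_σ₂, mul_assoc]

theorem σ₁_mul_delta_pow_three : σ₁ * δ * (σ₁ * δ) * (σ₁ * δ) = 1 := by
  calc σ₁ * δ * (σ₁ * δ) * (σ₁ * δ) = σ₁ * (δ * σ₁) * (δ * σ₁) * δ := by simp only [mul_assoc]
    _ = σ₁ * σ₂ * (δ * σ₂) * δ * δ := by rw [delta_mul_σ₁]; simp only [mul_assoc]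
    _ = δ ^ 4 := by rw [delta_mul_σ₂]; simp only [δ, pow_succ, pow_zero, one_mul, mul_assoc]
    _ = 1 := delta_pow_four

/-- Vertices of the Brady complex: cosets of the subgroup generated by `δ`. -/
abbrev Vert : Type := G ⧸ Subgroup.zpowers δ

theorem mk_mul_delta (g : G) : (QuotientGroup.mk (g * δ) : Vert) = QuotientGroup.mk g :=
  QuotientGroup.mk_mul_of_mem g (Subgroup.mem_zpowers δ)

theorem mk_mul_delta_sq (g : G) : (QuotientGroup.mk (g * δ ^ 2) : Vert) = QuotientGroup.mk g :=
  QuotientGroup.mk_mul_of_mem g (Subgroup.npow_mem_zpowers δ 2)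

/-- The Brady complex. The group `G` acts on it by left multiplication.

* The vertices are the cosets `[g] = g⟨δ⟩`.
* The edges are the elements `g` of `G`; the edge `g` joins `[g]` to `[g σ₁]`. As conjugation by
  `δ` permutes `σ₁`, `σ₂`, `σ₃`, `σ₄ := δ σ₃ δ⁻¹` cyclically, these are the edges joining `[g]` to
  `[g σ]` for `σ` one of these four generators.
* The triangles are those with vertices `[g]`, `[g σ₁]`, `[g σ₁ σ₂]` (note that
  `[g σ₁ σ₂ σ₃] = [g]`), one for each coset `g⟨σ₁ δ⟩`, as `σ₁ δ` permutes these three vertices.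
* The lozenges are those with vertices `[g σ₁]`, `[g σ₁ σ₃]`, `[g σ₃]`, `[g]`, one for each coset
  `g⟨δ²⟩`, as `δ²` exchanges `σ₁` and `σ₃`; the obtuse corners are `[g]` and `[g σ₁ σ₃]`.

The representative of a coset chosen by `Quotient.out` only affects which corner of the face is
listed first. -/
noncomputable def bradyComplex : LozengeComplex where
  Vert := Vert
  Edge := G
  Tri := G ⧸ Subgroup.zpowers (σ₁ * δ)
  Loz := G ⧸ Subgroup.zpowers (δ ^ 2)
  src g := QuotientGroup.mk g
  tgt g := QuotientGroup.mk (g * σ₁)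
  triSide t :=
    ![(t.out, true), (t.out * (σ₁ * δ), true), (t.out * (σ₁ * δ) * (σ₁ * δ), true)]
  lozSide l :=
    ![(l.out * σ₁ * δ ^ 2, true), (l.out * σ₃, false), (l.out * δ ^ 2, false), (l.out, true)]
  tri_closed := by
    intro t i
    generalize t.out = g
    fin_cases i
    · change (QuotientGroup.mk (g * (σ₁ * δ)) : Vert) = QuotientGroup.mk (g * σ₁)
      rw [← mul_assoc, mk_mul_delta]
    · change (QuotientGroup.mk (g * (σ₁ * δ) * (σ₁ * δ)) : Vert) =
        QuotientGroup.mk (g * (σ₁ * δ) * σ₁)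
      rw [← mul_assoc (g * (σ₁ * δ)), mk_mul_delta]
    · change (QuotientGroup.mk g : Vert) = QuotientGroup.mk (g * (σ₁ * δ) * (σ₁ * δ) * σ₁)
      rw [← mk_mul_delta (g * (σ₁ * δ) * (σ₁ * δ) * σ₁)]
      congr 1
      rw [mul_assoc _ σ₁ δ, mul_assoc g, mul_assoc g, σ₁_mul_delta_pow_three, mul_one]
  loz_closed := by
    intro l i
    generalize l.out = g
    fin_cases i
    · change (QuotientGroup.mk (g * σ₃ * σ₁) : Vert) = QuotientGroup.mk (g * σ₁ * δ ^ 2 * σ₁)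
      rw [mul_assoc _ (δ ^ 2), delta_sq_mul_σ₁, ← mul_assoc, mk_mul_delta_sq, mul_assoc g,
        mul_assoc g, comm13]
    · change (QuotientGroup.mk (g * δ ^ 2 * σ₁) : Vert) = QuotientGroup.mk (g * σ₃)
      rw [mul_assoc, delta_sq_mul_σ₁, ← mul_assoc, mk_mul_delta_sq]
    · change (QuotientGroup.mk g : Vert) = QuotientGroup.mk (g * δ ^ 2)
      rw [mk_mul_delta_sq]
    · change (QuotientGroup.mk (g * σ₁ * δ ^ 2) : Vert) = QuotientGroup.mk (g * σ₁)
      rw [mk_mul_delta_sq]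

end Brady

/-! The open stars of the cells cover a complex, and the preimage of the open star of a cell under a
combinatorial map is the disjoint union of the open stars of the cells above it as soon as the map
is bijective on links. So a surjective combinatorial map with this property is a covering.

The edges of the Brady complex `X` are the elements of `G`, which acts on them by multiplication on
the right. This action descends to the twelve edges of `V`: the permutations of `V`'s edges by
`σ₁` (which agrees with that by `σ₃`) and by `σ₂` satisfy the relations of `G`. The covering maps
the edge `g` to the image of `x_a` under `g`, and bijectivity on links becomes a finite check.

For the fundamental group `π` of `X` to vanish it suffices that the `π`-valued function on paths
which closes up each path to a loop has a primitive. As cells and open stars are contractible, it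
is determined by its values `ℓ : G → π` on the edges, and `ℓ` is flat: its product around each face
is trivial. Flatness on the triangles and lozenges says exactly that the pairs `(ℓ(· δⁱ), σᵢ₊₁)` in
the semidirect product of the functions `G → π` with `G` satisfy the defining relations of `G`. The
first component of the resulting section of the semidirect product is a crossed homomorphism;
evaluating its values at `1` gives a function `u : G → π` with `u (g σ₁) = u g * ℓ g` and
`u (g δ) = u g`, which descends to the vertices of `X` and extends to the required primitive.
-/

/-- A convex polygon in the Euclidean plane with `n` cyclically numbered corners. Side `i` joins
the corners `i` and `i + 1`. The polygon is given together with affine functions `height i`,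
multiples of the distance to the line through side `i`; it has the special feature, shared by
equilateral triangles and parallelograms, that all corners not on side `i` have the same distance
to this line, taken as unit of `height i`. -/
structure ModelPolygon (n : ℕ) [NeZero n] where
  corner : Fin n → ℂ
  height : Fin n → ℂ →ᵃ[ℝ] ℝ
  height_corner : ∀ i j, height i (corner j) = if j = i ∨ j = i + 1 then 0 else 1
  affineSpan_range_corner : affineSpan ℝ (Set.range corner) = ⊤
  three_le : 3 ≤ n

namespace ModelPolygon

open AffineMap Set

variable {n : ℕ} [NeZero n] (M : ModelPolygon n)

/-- The closed region bounded by the polygon. -/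
def shape : Set ℂ := convexHull ℝ (range M.corner)

/-- The part of the polygon belonging to the open star of corner `i`. -/
def NearCorner (i : Fin n) (z : ℂ) : Prop := M.height (i - 1) z + M.height i z < 1 / 2

/-- The part of the polygon belonging to the open star of side `i`. -/
def NearSide (i : Fin n) (z : ℂ) : Prop := ∀ j ≠ i, M.height i z < M.height j z

/-- The interior of the polygon. -/
def Inside (z : ℂ) : Prop := ∀ i, 0 < M.height i z

/-- The number of the corner at which side `i` begins, if the side is traversed from corner `i` to
corner `i + 1` for `b = true` and backwards for `b = false`. -/
def sideStart (i : Fin n) (b : Bool) : Fin n := bif b then i else i + 1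

theorem exists_eq_sideStart (k : Fin n) (b : Bool) : ∃ i, k = sideStart i b := by
  cases b
  · exact ⟨k - 1, (sub_add_cancel k 1).symm⟩
  · exact ⟨k, rfl⟩

/-- The parametrization of side `i`, traversed forwards (`b = true`) or backwards. -/
noncomputable def sideMap (i : Fin n) (b : Bool) : ℝ →ᵃ[ℝ] ℂ :=
  lineMap (M.corner (sideStart i b)) (M.corner (sideStart i !b))

section Cyclic

include M

theorem add_one_ne_self (i : Fin n) : i + 1 ≠ i := by
  have := M.three_le
  intro h
  have h1 : (1 : Fin n) = 0 := by simpa using h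
  simp [Fin.ext_iff, Nat.mod_eq_of_lt (show 1 < n by omega)] at h1

theorem add_one_add_one_ne_self (i : Fin n) : i + 1 + 1 ≠ i := by
  have := M.three_le
  intro h
  have h1 : (1 + 1 : Fin n) = 0 := by simpa [add_assoc] using h
  simp [Fin.ext_iff, Fin.val_add, Nat.mod_eq_of_lt (show 1 < n by omega),
    Nat.mod_eq_of_lt (show 2 < n by omega)] at h1

theorem eq_of_mem_sides {i j : Fin n} (h : i = j ∨ i = j + 1) (h' : i + 1 = j ∨ i + 1 = j + 1) :
    i = j := by
  rcases h with h | rfl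
  · exact h
  · rcases h' with h' | h'
    · exact absurd h' (M.add_one_add_one_ne_self j)
    · exact add_right_cancel h'

end Cyclic

theorem corner_mem_shape (i : Fin n) : M.corner i ∈ M.shape :=
  subset_convexHull ℝ _ (mem_range_self i)

theorem convex_shape : Convex ℝ M.shape := convex_convexHull ℝ _

theorem le_of_mem_shape {f : ℂ →ᵃ[ℝ] ℝ} {c : ℝ} (h : ∀ i, c ≤ f (M.corner i)) {z : ℂ}
    (hz : z ∈ M.shape) : c ≤ f z := by
  have hconv : Convex ℝ (f ⁻¹' Ici c) := (convex_Ici c).affine_preimage f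
  have hsub : M.shape ⊆ f ⁻¹' Ici c := convexHull_min (range_subset_iff.2 h) hconv
  exact hsub hz

theorem height_corner_nonneg (i j : Fin n) : 0 ≤ M.height i (M.corner j) := by
  rw [height_corner]
  split_ifs <;> norm_num

theorem height_nonneg {z : ℂ} (hz : z ∈ M.shape) (i : Fin n) : 0 ≤ M.height i z :=
  M.le_of_mem_shape (M.height_corner_nonneg i) hz

theorem continuous_height (i : Fin n) : Continuous (M.height i) :=
  (M.height i).continuous_of_finiteDimensional

theorem height_corner_eq_zero {i j : Fin n} :
    M.height i (M.corner j) = 0 ↔ j = i ∨ j = i + 1 := by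
  rw [height_corner, ite_eq_left_iff, imp_iff_not (one_ne_zero), not_not]

theorem corner_injective : Function.Injective M.corner := by
  intro i j h
  have h1 := M.height_corner_eq_zero (i := j) (j := i)
  have h2 := M.height_corner_eq_zero (i := j - 1) (j := i)
  rw [h, sub_add_cancel] at h2
  rw [h, height_corner_eq_zero] at h1
  simp only [height_corner_eq_zero, sub_add_cancel, or_true, true_iff] at h2
  rcases h1.1 (.inl rfl) with h1 | rfl
  · exact h1
  · rcases h2 with h2 | h2
    · exact absurd (eq_sub_iff_add_eq.1 h2) (M.add_one_add_one_ne_self j)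
    · exact h2

theorem isOpen_nearCorner (i : Fin n) : IsOpen {z | M.NearCorner i z} :=
  isOpen_lt ((M.continuous_height _).add (M.continuous_height i)) continuous_const

theorem isOpen_nearSide (i : Fin n) : IsOpen {z | M.NearSide i z} := by
  simp only [NearSide, ofPred_forall]
  exact isOpen_iInter_of_finite fun j => isOpen_iInter_of_finite fun _ =>
    isOpen_lt (M.continuous_height i) (M.continuous_height j)

theorem isOpen_inside : IsOpen {z | M.Inside z} := by
  simp only [Inside, ofPred_forall]
  exact isOpen_iInter_of_finite fun j => isOpen_lt continuous_const (M.continuous_height j)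

theorem one_le_height_add_height {i j : Fin n} (hij : j ≠ i) :
    1 ≤ M.height (i - 1) (M.corner j) + M.height i (M.corner j) := by
  have h : ¬ (j = i - 1 ∨ j = i) ∨ ¬ (j = i ∨ j = i + 1) := by
    by_contra! h
    rcases h.1.resolve_right hij with rfl
    exact M.add_one_add_one_ne_self (i - 1)
      (by rw [sub_add_cancel]; exact (h.2.resolve_left hij).symm)
  have h1 := M.height_corner_nonneg (i - 1) j
  have h2 := M.height_corner_nonneg i j
  rcases h with h | h
  · rw [M.height_corner (i - 1), sub_add_cancel, if_neg h]
    linarith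
  · rw [M.height_corner i, if_neg h]
    linarith

variable {M} in
theorem NearCorner.unique {i j : Fin n} {z : ℂ} (hz : z ∈ M.shape) (hi : M.NearCorner i z)
    (hj : M.NearCorner j z) : i = j := by
  by_contra hij
  let f := M.height (i - 1) + M.height i + (M.height (j - 1) + M.height j)
  have hf : 1 ≤ f z := by
    refine M.le_of_mem_shape (fun k => ?_) hz
    have h0 := M.height_corner_nonneg
    simp only [f, AffineMap.coe_add, Pi.add_apply]
    by_cases hki : k = i
    · linarith [M.one_le_height_add_height (fun h => hij (hki.symm.trans h)), h0 (i - 1) k, h0 i k]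
    · linarith [M.one_le_height_add_height hki, h0 (j - 1) k, h0 j k]
  simp only [f, AffineMap.coe_add, Pi.add_apply] at hf
  unfold NearCorner at hi hj
  linarith

variable {M} in
theorem NearSide.unique {i j : Fin n} {z : ℂ} (hi : M.NearSide i z) (hj : M.NearSide j z) :
    i = j := by
  by_contra hij
  exact lt_asymm (hi j (Ne.symm hij)) (hj i hij)

theorem eq_add_one_of_height_eq_zero {i j : Fin n} (hij : i ≠ j) {z : ℂ} (hz : z ∈ M.shape)
    (hi : M.height i z = 0) (hj : M.height j z = 0) : i = j + 1 ∨ j = i + 1 := by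
  by_contra! hadj
  have h : 1 ≤ (M.height i + M.height j) z := by
    refine M.le_of_mem_shape (fun k => ?_) hz
    have h1 := M.height_corner_nonneg i k
    have h2 := M.height_corner_nonneg j k
    simp only [AffineMap.coe_add, Pi.add_apply]
    by_cases hk : k = i ∨ k = i + 1
    · have : ¬ (k = j ∨ k = j + 1) := by
        rcases hk with rfl | rfl
        · exact not_or.2 ⟨hij, hadj.1⟩
        · exact not_or.2 ⟨hadj.2.symm, fun h => hij (add_right_cancel h)⟩
      rw [M.height_corner j, if_neg this]
      linarith
    · rw [M.height_corner i, if_neg hk]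
      linarith
  simp only [AffineMap.coe_add, Pi.add_apply, hi, hj] at h
  norm_num at h

theorem covered {z : ℂ} (hz : z ∈ M.shape) :
    (∃ i, M.NearCorner i z) ∨ (∃ i, M.NearSide i z) ∨ M.Inside z := by
  by_cases hin : M.Inside z
  · exact .inr (.inr hin)
  obtain ⟨i, hi⟩ : ∃ i, M.height i z ≤ 0 := by simpa [Inside] using hin
  replace hi := le_antisymm hi (M.height_nonneg hz i)
  by_cases hside : M.NearSide i z
  · exact .inr (.inl ⟨i, hside⟩)
  obtain ⟨j, hij, hj⟩ : ∃ j ≠ i, M.height j z ≤ M.height i z := by simpa [NearSide] using hside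
  replace hj := le_antisymm (hj.trans hi.le) (M.height_nonneg hz j)
  rcases M.eq_add_one_of_height_eq_zero hij hz hj hi with rfl | rfl
  · exact .inl ⟨i + 1, by simp [NearCorner, hi, hj]⟩
  · exact .inl ⟨j + 1, by simp [NearCorner, hi, hj]⟩

section Sides

variable {M} {i : Fin n} {s : ℝ}

theorem sideMap_mem_shape (b : Bool) (hs : s ∈ Icc 0 1) : M.sideMap i b s ∈ M.shape :=
  M.convex_shape.lineMap_mem (M.corner_mem_shape _) (M.corner_mem_shape _) hs

theorem sideMap_not (b : Bool) : M.sideMap i (!b) s = M.sideMap i b (1 - s) := by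
  simp [sideMap, lineMap_apply_one_sub]

theorem height_sideMap (b : Bool) (j : Fin n) : M.height j (M.sideMap i b s) =
    (1 - s) * M.height j (M.corner (sideStart i b)) +
      s * M.height j (M.corner (sideStart i !b)) := by
  simp only [sideMap, apply_lineMap, lineMap_apply_ring']
  ring

theorem height_sideMap_self (b : Bool) : M.height i (M.sideMap i b s) = 0 := by
  cases b <;> simp [height_sideMap, height_corner, sideStart]

theorem height_sideMap_pos (hs : 0 < s) (hs' : s < 1) {j : Fin n} (hj : j ≠ i) :
    0 < M.height j (M.sideMap i true s) := by
  have : 0 < 1 - s := sub_pos.2 hs'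
  have h : ¬ (i = j ∨ i = j + 1) ∨ ¬ (i + 1 = j ∨ i + 1 = j + 1) := by
    by_contra! h
    exact hj (M.eq_of_mem_sides h.1 h.2).symm
  have h1 := M.height_corner_nonneg j i
  have h2 := M.height_corner_nonneg j (i + 1)
  simp only [height_sideMap, sideStart, Bool.not_true, cond_true, cond_false]
  rcases h with h | h
  · rw [M.height_corner j i, if_neg h]
    positivity
  · rw [M.height_corner j (i + 1), if_neg h]
    positivity

theorem height_sub_one_sideMap : M.height (i - 1) (M.sideMap i true s) = s := by
  have h : ¬ (i + 1 = i - 1 ∨ i + 1 = i) := by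
    refine not_or.2 ⟨fun h => ?_, M.add_one_ne_self i⟩
    exact M.add_one_add_one_ne_self i (eq_sub_iff_add_eq.1 h)
  simp only [height_sideMap, sideStart, Bool.not_true, cond_true, cond_false]
  rw [height_corner, height_corner, sub_add_cancel, if_neg h,
    if_pos (.inr rfl), mul_zero, zero_add, mul_one]

theorem height_add_one_sideMap : M.height (i + 1) (M.sideMap i true s) = 1 - s := by
  have h : ¬ (i = i + 1 ∨ i = i + 1 + 1) :=
    not_or.2 ⟨(M.add_one_ne_self i).symm, (M.add_one_add_one_ne_self i).symm⟩
  simp only [height_sideMap, sideStart, Bool.not_true, cond_true, cond_false]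
  rw [height_corner, height_corner, if_neg h, if_pos (.inl rfl), mul_zero,
    add_zero, mul_one]

theorem nearCorner_sideMap (b : Bool) :
    M.NearCorner (sideStart i b) (M.sideMap i b s) ↔ s < 1 / 2 := by
  cases b
  · rw [← Bool.not_true, sideMap_not]
    simp only [NearCorner, sideStart, Bool.not_true, cond_false, add_sub_cancel_right,
      height_sideMap_self, height_add_one_sideMap]
    constructor <;> intro h <;> linarith
  · simp only [NearCorner, sideStart, cond_true, height_sub_one_sideMap, height_sideMap_self,
      add_zero]

theorem nearCorner_sideMap_xor (b b' : Bool) :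
    M.NearCorner (sideStart i !(b' ^^ b)) (M.sideMap i b s) ↔
      (bif b' then s else 1 - s) < 1 / 2 := by
  cases b'
  · rw [Bool.false_xor, cond_false, ← nearCorner_sideMap (M := M) (i := i), sideMap_not,
      sub_sub_cancel]
  · rw [Bool.true_xor, Bool.not_not, cond_true, nearCorner_sideMap]

theorem NearCorner.of_sideMap (b : Bool) (hs : s ∈ Icc 0 1) {j : Fin n}
    (h : M.NearCorner j (M.sideMap i b s)) : ∃ b', j = sideStart i b' := by
  by_contra! hj
  have h1 := M.one_le_height_add_height (hj b).symm
  have h2 := M.one_le_height_add_height (hj !b).symm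
  simp only [NearCorner, height_sideMap] at h
  nlinarith [hs.1, hs.2]

theorem nearSide_sideMap (b : Bool) : M.NearSide i (M.sideMap i b s) ↔ 0 < s ∧ s < 1 := by
  have h (t : ℝ) : M.NearSide i (M.sideMap i true t) ↔ 0 < t ∧ t < 1 := by
    refine ⟨fun h => ⟨?_, ?_⟩, fun h j hj => ?_⟩
    · have := h (i - 1) fun e => M.add_one_ne_self (i - 1) (by rw [sub_add_cancel, e])
      rwa [height_sideMap_self, height_sub_one_sideMap] at this
    · have := h (i + 1) (M.add_one_ne_self i)
      rwa [height_sideMap_self, height_add_one_sideMap, sub_pos] at this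
    · rw [height_sideMap_self]
      exact height_sideMap_pos h.1 h.2 hj
  cases b
  · rw [← Bool.not_true, sideMap_not, h, sub_pos, sub_lt_self_iff, and_comm]
  · exact h s

theorem NearSide.of_sideMap (b : Bool) (hs : s ∈ Icc 0 1) {j : Fin n}
    (h : M.NearSide j (M.sideMap i b s)) : j = i := by
  by_contra hj
  have := h i (Ne.symm hj)
  rw [height_sideMap_self] at this
  exact absurd this (M.height_nonneg (sideMap_mem_shape b hs) j).not_gt

theorem not_inside_sideMap (b : Bool) : ¬ M.Inside (M.sideMap i b s) := fun h =>
  (h i).ne' (height_sideMap_self b)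

end Sides

end ModelPolygon

/-- An isometry between two model polygons. It maps side `i` to side `side i`, preserving the
direction of all sides if `reversed = false` and reversing it if `reversed = true`. -/
structure PolygonIso {n m : ℕ} [NeZero n] [NeZero m] (M : ModelPolygon n) (M' : ModelPolygon m)
    where
  toIso : ℂ ≃ᵃⁱ[ℝ] ℂ
  side : Fin n ≃ Fin m
  reversed : Bool
  map_sideStart : ∀ i b, toIso (M.corner (ModelPolygon.sideStart i b)) =
    M'.corner (ModelPolygon.sideStart (side i) (reversed ^^ b))

namespace PolygonIso

open ModelPolygon Set

variable {n m : ℕ} [NeZero n] [NeZero m] {M : ModelPolygon n} {M' : ModelPolygon m}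
  (D : PolygonIso M M')

/-- The effect of an isometry on the numbers of the corners. -/
def cornerMap (i : Fin n) : Fin m := sideStart (D.side i) !D.reversed

theorem map_corner (i : Fin n) : D.toIso (M.corner i) = M'.corner (D.cornerMap i) := by
  rw [cornerMap, ← Bool.xor_true]
  exact D.map_sideStart i true

theorem cornerMap_sideStart (i : Fin n) (b : Bool) :
    D.cornerMap (sideStart i b) = sideStart (D.side i) (D.reversed ^^ b) :=
  M'.corner_injective ((D.map_corner _).symm.trans (D.map_sideStart i b))

theorem cornerMap_sideStart_not_reversed (i : Fin n) :
    D.cornerMap (sideStart i !D.reversed) = D.side i := by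
  rw [cornerMap_sideStart, Bool.xor_not_self]
  rfl

theorem cornerMap_injective : Function.Injective D.cornerMap := fun i j h =>
  M.corner_injective (D.toIso.injective (by rw [map_corner, map_corner, h]))

theorem cornerMap_surjective : Function.Surjective D.cornerMap := by
  intro k
  obtain ⟨j, rfl⟩ := exists_eq_sideStart k !D.reversed
  exact ⟨D.side.symm j, by rw [cornerMap, Equiv.apply_symm_apply]⟩

theorem cornerMap_mem_side_iff (i j : Fin n) :
    (D.cornerMap j = D.side i ∨ D.cornerMap j = D.side i + 1) ↔ j = i ∨ j = i + 1 := by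
  have h (b : Bool) : D.cornerMap j = sideStart (D.side i) (D.reversed ^^ b) ↔
      j = sideStart i b := by
    rw [← cornerMap_sideStart, D.cornerMap_injective.eq_iff]
  have h1 := h true
  have h2 := h false
  cases hr : D.reversed <;>
    simp only [hr, sideStart, Bool.xor_true, Bool.xor_false, Bool.not_true, Bool.not_false,
      cond_true, cond_false] at h1 h2
  · exact or_congr h1 h2
  · rw [or_comm, h1, h2]

theorem height_toIso (i : Fin n) (z : ℂ) : M'.height (D.side i) (D.toIso z) = M.height i z := by
  have h : (M'.height (D.side i)).comp D.toIso.toAffineEquiv.toAffineMap = M.height i := by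
    refine AffineMap.ext_on M.affineSpan_range_corner ?_
    rintro _ ⟨j, rfl⟩
    simp [map_corner, height_corner, D.cornerMap_mem_side_iff]
  exact DFunLike.congr_fun h z

theorem image_shape : D.toIso '' M.shape = M'.shape := by
  have h : D.toIso.toAffineEquiv.toAffineMap '' range M.corner = range M'.corner := by
    rw [← range_comp, ← D.cornerMap_surjective.range_comp]
    exact congrArg range (funext D.map_corner)
  rw [shape, shape, ← h, ← AffineMap.image_convexHull]
  rfl

theorem inside_toIso {z : ℂ} : M'.Inside (D.toIso z) ↔ M.Inside z := by
  simp only [Inside, D.side.surjective.forall, height_toIso]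

theorem nearSide_toIso {i : Fin n} {z : ℂ} :
    M'.NearSide (D.side i) (D.toIso z) ↔ M.NearSide i z := by
  simp only [NearSide, D.side.surjective.forall, height_toIso, ne_eq, D.side.injective.eq_iff]

theorem sides_at_cornerMap (i : Fin n) :
    D.cornerMap i - 1 = D.side (i - 1) ∧ D.cornerMap i = D.side i ∨
      D.cornerMap i - 1 = D.side i ∧ D.cornerMap i = D.side (i - 1) := by
  have h := D.cornerMap_sideStart (i - 1) false
  have h' := D.cornerMap_sideStart i true
  simp only [sideStart, cond_true, cond_false, sub_add_cancel] at h h'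
  cases hr : D.reversed <;>
    simp only [hr, Bool.xor_true, Bool.xor_false, Bool.not_true, Bool.not_false, cond_true,
      cond_false] at h h'
  · exact .inl ⟨by rw [h, add_sub_cancel_right], h'⟩
  · exact .inr ⟨by rw [h', add_sub_cancel_right], h⟩

theorem nearCorner_toIso {i : Fin n} {z : ℂ} :
    M'.NearCorner (D.cornerMap i) (D.toIso z) ↔ M.NearCorner i z := by
  unfold NearCorner
  rcases D.sides_at_cornerMap i with ⟨h, h'⟩ | ⟨h, h'⟩ <;> rw [h, h', height_toIso, height_toIso]
  rw [add_comm]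

theorem sideMap_toIso (i : Fin n) (b : Bool) (s : ℝ) :
    D.toIso (M.sideMap i b s) = M'.sideMap (D.side i) (D.reversed ^^ b) s := by
  have h := D.toIso.toAffineEquiv.toAffineMap.apply_lineMap (M.corner (sideStart i b))
    (M.corner (sideStart i !b)) s
  refine h.trans ?_
  simp [sideMap, map_sideStart]

end PolygonIso

namespace LozengeComplex

/-- The first coordinate with respect to the basis `1`, `omega` of the plane. -/
noncomputable def coordA : ℂ →ₗ[ℝ] ℝ := Complex.reLm - (1 / √3) • Complex.imLm

/-- The second coordinate with respect to the basis `1`, `omega` of the plane. -/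
noncomputable def coordB : ℂ →ₗ[ℝ] ℝ := (2 / √3) • Complex.imLm

theorem coordA_one : coordA 1 = 1 := by simp [coordA]

theorem coordB_one : coordB 1 = 0 := by simp [coordB]

theorem coordA_omega : coordA omega = 0 := by simp [coordA, omega]; field_simp; norm_num

theorem coordB_omega : coordB omega = 1 := by simp [coordB, omega]

theorem coordA_smul_one_add_coordB_smul_omega (z : ℂ) :
    coordA z • (1 : ℂ) + coordB z • omega = z := by
  have h3 : (√3 : ℝ) ^ 2 = 3 := Real.sq_sqrt (by norm_num)
  apply Complex.ext <;> simp [coordA, coordB, omega] <;> field_simp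
  linear_combination -z.im * h3

theorem affineSpan_eq_top {s : Set ℂ} (h0 : 0 ∈ s) (h1 : 1 ∈ s) (hω : omega ∈ s) :
    affineSpan ℝ s = ⊤ := by
  refine AffineSubspace.ext fun z => iff_of_true ?_ (AffineSubspace.mem_top ℝ ℂ z)
  have mem {w : ℂ} (hw : w ∈ s) : w ∈ affineSpan ℝ s := subset_affineSpan ℝ s hw
  have h := (affineSpan ℝ s).smul_vsub_vadd_mem (coordA z) (mem h1) (mem h0)
    ((affineSpan ℝ s).smul_vsub_vadd_mem (coordB z) (mem hω) (mem h0) (mem h0))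
  rwa [vsub_eq_sub, vsub_eq_sub, sub_zero, sub_zero, vadd_eq_add, vadd_eq_add, add_zero,
    coordA_smul_one_add_coordB_smul_omega] at h

open AffineMap in
/-- The equilateral triangle with its corners `triCorner`. -/
noncomputable def trianglePolygon : ModelPolygon 3 where
  corner := triCorner
  height := ![coordB.toAffineMap, const ℝ ℂ 1 - coordA.toAffineMap - coordB.toAffineMap,
    coordA.toAffineMap]
  height_corner i j := by
    fin_cases i <;> fin_cases j <;>
      simp [triCorner, coordA_one, coordB_one, coordA_omega, coordB_omega]
  affineSpan_range_corner := affineSpan_eq_top ⟨0, rfl⟩ ⟨1, rfl⟩ ⟨2, rfl⟩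
  three_le := le_rfl

open AffineMap in
/-- The lozenge with its corners `lozCorner`. -/
noncomputable def lozengePolygon : ModelPolygon 4 where
  corner := lozCorner
  height := ![coordB.toAffineMap, const ℝ ℂ 1 - coordA.toAffineMap,
    const ℝ ℂ 1 - coordB.toAffineMap, coordA.toAffineMap]
  height_corner i j := by
    fin_cases i <;> fin_cases j <;>
      simp [lozCorner, coordA_one, coordB_one, coordA_omega, coordB_omega]
  affineSpan_range_corner := affineSpan_eq_top ⟨0, rfl⟩ ⟨1, rfl⟩ ⟨3, rfl⟩
  three_le := by norm_num

/-- The two-dimensional cells of a complex, so that triangles and lozenges can be treated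
alike. -/
inductive Face (K : LozengeComplex) : Type
  | tri (t : K.Tri) : Face K
  | loz (l : K.Loz) : Face K

variable {K : LozengeComplex}

/-- The vertex at which an oriented edge starts. -/
def start (K : LozengeComplex) (s : K.Edge × Bool) : K.Vert := bif s.2 then K.src s.1 else K.tgt s.1

namespace Face

/-- A face as a closed cell. -/
def cell : K.Face → K.Cell
  | tri t => .tri t
  | loz l => .loz l

/-- The number of sides of a face. -/
def card : K.Face → ℕ
  | tri _ => 3
  | loz _ => 4

instance (F : K.Face) : NeZero F.card := ⟨by cases F <;> simp [card]⟩

/-- The Euclidean model of a face. -/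
noncomputable def polygon : (F : K.Face) → ModelPolygon F.card
  | tri _ => trianglePolygon
  | loz _ => lozengePolygon

/-- The boundary of a face. -/
def side : (F : K.Face) → Fin F.card → K.Edge × Bool
  | tri t => K.triSide t
  | loz l => K.lozSide l

theorem shape_cell (F : K.Face) : F.cell.shape = F.polygon.shape := by
  cases F <;> rfl

theorem cell_injective : Function.Injective (cell (K := K)) := by
  rintro (t | l) (t' | l') h <;> cases h <;> rfl

theorem start_side_sideStart (F : K.Face) (i : Fin F.card) (b : Bool) :
    K.start (F.side (ModelPolygon.sideStart i b)) =
      K.start ((F.side i).1, !(b ^^ (F.side i).2)) := by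
  cases b
  · have h : K.start (F.side (i + 1)) =
        bif (F.side i).2 then K.tgt (F.side i).1 else K.src (F.side i).1 := by
      cases F
      · exact K.tri_closed _ i
      · exact K.loz_closed _ i
    refine h.trans ?_
    cases (F.side i).2 <;> rfl
  · simp [ModelPolygon.sideStart]

theorem cell_ne_vert (F : K.Face) (v : K.Vert) : F.cell ≠ .vert v := by
  cases F <;> rintro ⟨⟩

theorem cell_ne_edge (F : K.Face) (e : K.Edge) : F.cell ≠ .edge e := by
  cases F <;> rintro ⟨⟩

end Face

namespace Cell

/-- The dimension of a closed cell. -/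
def dim : K.Cell → ℕ
  | vert _ => 0
  | edge _ => 1
  | tri _ => 2
  | loz _ => 2

theorem dim_vert (v : K.Vert) : (vert v).dim = 0 := rfl

theorem dim_edge (e : K.Edge) : (edge e).dim = 1 := rfl

theorem dim_cell (F : K.Face) : F.cell.dim = 2 := by
  cases F <;> rfl

@[elab_as_elim]
theorem faceCases {motive : K.Cell → Prop} (vert : ∀ v, motive (.vert v))
    (edge : ∀ e, motive (.edge e)) (face : ∀ F : K.Face, motive F.cell) (c : K.Cell) :
    motive c := by
  cases c with
  | vert v => exact vert v
  | edge e => exact edge e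
  | tri t => exact face (.tri t)
  | loz l => exact face (.loz l)

theorem mem_shape_edge {e : K.Edge} {z : ℂ} :
    z ∈ (edge e : K.Cell).shape ↔ z.re ∈ Set.Icc 0 1 ∧ z.im = 0 := by
  rw [shape, segment_eq_image]
  constructor
  · rintro ⟨s, hs, rfl⟩
    simpa using hs
  · rintro ⟨hz, him⟩
    exact ⟨z.re, hz, Complex.ext (by simp) (by simp [him])⟩

end Cell

theorem PreRealization.ext {a b : K.PreRealization} (h : a.1 = b.1) (h' : (a.2 : ℂ) = b.2) :
    a = b := by
  obtain ⟨c, x⟩ := a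
  obtain ⟨d, y⟩ := b
  obtain rfl : c = d := h
  exact congrArg _ (Subtype.ext h')

/-- The ways in which a closed cell, the `cell` of the incidence, occurs in the boundary of a
closed cell, the `host`, or coincides with it. The incidence `endpoint s` is the starting point of
the oriented edge `s`. -/
inductive Incidence (K : LozengeComplex) : Type
  | vert (v : K.Vert) : Incidence K
  | endpoint (s : K.Edge × Bool) : Incidence K
  | edge (e : K.Edge) : Incidence K
  | corner (F : K.Face) (i : Fin F.card) : Incidence K
  | side (F : K.Face) (i : Fin F.card) : Incidence K
  | face (F : K.Face) : Incidence K

namespace Incidence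

/-- The larger cell of an incidence. -/
def host : K.Incidence → K.Cell
  | vert v => .vert v
  | endpoint s => .edge s.1
  | edge e => .edge e
  | corner F _ => F.cell
  | side F _ => F.cell
  | face F => F.cell

/-- The smaller cell of an incidence. -/
def cell : K.Incidence → K.Cell
  | vert v => .vert v
  | endpoint s => .vert (K.start s)
  | edge e => .edge e
  | corner F i => .vert (K.start (F.side i))
  | side F i => .edge (F.side i).1
  | face F => F.cell

/-- The position of the smaller cell of an incidence in the model of the larger one. -/
noncomputable def embed : K.Incidence → ℂ → ℂ
  | vert _ => id
  | endpoint s => fun _ => bif s.2 then 0 else 1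
  | edge _ => id
  | corner F i => fun _ => F.polygon.corner i
  | side F i => fun z => F.polygon.sideMap i (F.side i).2 z.re
  | face _ => id

/-- The part of the model of the larger cell of an incidence that belongs to the open star of the
smaller one. -/
def region : K.Incidence → Set ℂ
  | vert _ => Set.univ
  | endpoint s => {z | (bif s.2 then z.re else 1 - z.re) < 1 / 2}
  | edge _ => {z | 0 < z.re ∧ z.re < 1}
  | corner F i => {z | F.polygon.NearCorner i z}
  | side F i => {z | F.polygon.NearSide i z}
  | face F => {z | F.polygon.Inside z}

/-- The incidences between cells whose dimensions differ by one. -/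
inductive IsFacet : K.Incidence → Prop
  | endpoint (s : K.Edge × Bool) : IsFacet (endpoint s)
  | side (F : K.Face) (i : Fin F.card) : IsFacet (side F i)

theorem isOpen_region (ρ : K.Incidence) : IsOpen ρ.region := by
  cases ρ with
  | vert v => exact isOpen_univ
  | endpoint s =>
    rcases s with ⟨e, _ | _⟩
    · exact isOpen_lt (continuous_const.sub Complex.continuous_re) continuous_const
    · exact isOpen_lt Complex.continuous_re continuous_const
  | edge e =>
    exact (isOpen_lt continuous_const Complex.continuous_re).inter
      (isOpen_lt Complex.continuous_re continuous_const)
  | corner F i => exact F.polygon.isOpen_nearCorner i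
  | side F i => exact F.polygon.isOpen_nearSide i
  | face F => exact F.polygon.isOpen_inside

theorem exists_mem_region {c : K.Cell} {z : ℂ} (hz : z ∈ c.shape) :
    ∃ ρ : K.Incidence, ρ.host = c ∧ z ∈ ρ.region := by
  induction c using Cell.faceCases with
  | vert v => exact ⟨vert v, rfl, trivial⟩
  | edge e =>
    rcases lt_trichotomy z.re (1 / 2) with h | h | h
    · exact ⟨endpoint (e, true), rfl, h⟩
    · exact ⟨edge e, rfl, by rw [region, Set.mem_ofPred_eq, h]; norm_num⟩
    · exact ⟨endpoint (e, false), rfl, show 1 - z.re < 1 / 2 by linarith⟩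
  | face F =>
    rw [F.shape_cell] at hz
    rcases F.polygon.covered hz with ⟨i, h⟩ | ⟨i, h⟩ | h
    · exact ⟨corner F i, rfl, h⟩
    · exact ⟨side F i, rfl, h⟩
    · exact ⟨face F, rfl, h⟩

theorem eq_of_mem_region {ρ ρ' : K.Incidence} (hhost : ρ.host = ρ'.host)
    (hdim : ρ.cell.dim = ρ'.cell.dim) {z : ℂ} (hz : z ∈ ρ.host.shape) (h : z ∈ ρ.region)
    (h' : z ∈ ρ'.region) : ρ = ρ' := by
  cases ρ <;> cases ρ' <;>
    simp only [host, cell, Cell.dim_vert, Cell.dim_edge, Cell.dim_cell, Cell.vert.injEq,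
      Cell.edge.injEq, Face.cell_injective.eq_iff, Face.cell_ne_vert, Face.cell_ne_edge,
      (Face.cell_ne_vert _ _).symm, (Face.cell_ne_edge _ _).symm, reduceCtorEq,
      OfNat.ofNat_ne_zero, OfNat.ofNat_ne_one, (OfNat.ofNat_ne_zero 2).symm,
      (OfNat.ofNat_ne_one 2).symm, zero_ne_one, one_ne_zero] at hhost hdim
  · rw [hhost]
  · rename_i s s'
    obtain ⟨e, b⟩ := s
    obtain ⟨e', b'⟩ := s'
    obtain rfl : e = e' := hhost
    cases b <;> cases b' <;>
      simp only [region, Set.mem_ofPred_eq, cond_true, cond_false] at h h' <;>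
      first | rfl | linarith
  · rw [hhost]
  · subst hhost
    rw [host, Face.shape_cell] at hz
    rw [ModelPolygon.NearCorner.unique hz h h']
  · subst hhost
    exact congrArg _ (ModelPolygon.NearSide.unique (z := z) h h')
  · rw [hhost]

theorem exists_comp {ρ₀ ρ : K.Incidence} (hρ₀ : ρ₀.IsFacet) (hhost : ρ.host = ρ₀.cell) {z : ℂ}
    (hz : z ∈ ρ.region) :
    ∃ ρ' : K.Incidence, ρ'.host = ρ₀.host ∧ ρ'.cell = ρ.cell ∧ ρ₀.embed z ∈ ρ'.region := by
  rcases hρ₀ with s | ⟨F, i⟩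
  · cases ρ <;> simp only [host, cell, Cell.vert.injEq, Face.cell_ne_vert, reduceCtorEq] at hhost
    refine ⟨endpoint s, rfl, congrArg Cell.vert hhost.symm, ?_⟩
    rcases s with ⟨e, _ | _⟩ <;> norm_num [region, embed]
  · cases ρ <;> simp only [host, cell, Cell.edge.injEq, Face.cell_ne_edge, reduceCtorEq] at hhost
    · rename_i s
      refine ⟨corner F (ModelPolygon.sideStart i !(s.2 ^^ (F.side i).2)), rfl, ?_,
        (ModelPolygon.nearCorner_sideMap_xor _ _).2 hz⟩
      obtain ⟨e, b⟩ := s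
      obtain rfl : e = (F.side i).1 := hhost
      simp [cell, F.start_side_sideStart]
    · exact ⟨side F i, rfl, congrArg Cell.edge hhost.symm,
        (ModelPolygon.nearSide_sideMap _).2 hz⟩

theorem exists_factor {ρ₀ ρ' : K.Incidence} (hρ₀ : ρ₀.IsFacet) (hhost : ρ'.host = ρ₀.host) {z : ℂ}
    (hz : z ∈ ρ₀.cell.shape) (hz' : ρ₀.embed z ∈ ρ'.region) :
    ∃ ρ : K.Incidence, ρ.host = ρ₀.cell ∧ ρ.cell = ρ'.cell ∧ z ∈ ρ.region ∧
      ∀ w, ρ'.embed w = ρ₀.embed (ρ.embed w) := by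
  rcases hρ₀ with ⟨e, b⟩ | ⟨F, i⟩
  · cases ρ' <;> simp only [host, Cell.edge.injEq, Face.cell_ne_edge, reduceCtorEq] at hhost
    · rename_i s
      obtain ⟨e', b'⟩ := s
      obtain rfl : e' = e := hhost
      obtain rfl : b' = b := by
        cases b <;> cases b' <;> norm_num [region, embed] at hz' <;> rfl
      exact ⟨vert _, rfl, rfl, trivial, fun _ => rfl⟩
    · cases b <;> norm_num [region, embed] at hz'
  · obtain ⟨hre, -⟩ := Cell.mem_shape_edge.1 hz
    cases ρ' <;> simp only [host, Face.cell_injective.eq_iff, (Face.cell_ne_edge _ _).symm,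
      (Face.cell_ne_vert _ _).symm] at hhost <;>
      obtain rfl := hhost.symm
    · obtain ⟨b', rfl⟩ := ModelPolygon.NearCorner.of_sideMap _ hre hz'
      obtain ⟨b, rfl⟩ : ∃ b, b' = !(b ^^ (F.side i).2) :=
        ⟨!(b' ^^ (F.side i).2), by simp⟩
      refine ⟨endpoint ((F.side i).1, b), rfl, ?_,
        (ModelPolygon.nearCorner_sideMap_xor _ _).1 hz', fun _ => ?_⟩
      · simp [cell, F.start_side_sideStart]
      · cases b <;> simp [embed, ModelPolygon.sideMap]
    · obtain rfl := ModelPolygon.NearSide.of_sideMap _ hre hz'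
      exact ⟨edge _, rfl, rfl, (ModelPolygon.nearSide_sideMap _).1 hz', fun _ => rfl⟩
    · exact absurd hz' (ModelPolygon.not_inside_sideMap _)

end Incidence

end LozengeComplex

namespace LozengeComplex

variable {K : LozengeComplex}

open Incidence

/-- The gluing of a side of a face to an edge, in the notation of `Glue` and of `embed`. -/
theorem eq_sideMap_iff {n : ℕ} [NeZero n] (M : ModelPolygon n) (i : Fin n) (b : Bool) {x y : ℂ}
    (hy : y.im = 0) : x = M.sideMap i b y.re ↔
      ∃ s : ℝ, x = AffineMap.lineMap (M.corner i) (M.corner (i + 1)) s ∧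
        y = bif b then (s : ℂ) else 1 - (s : ℂ) := by
  have hre : (y.re : ℂ) = y := Complex.ext rfl (by simp [hy])
  cases b
  · constructor
    · rintro rfl
      exact ⟨1 - y.re, M.sideMap_not (i := i) true, by simp [hre]⟩
    · rintro ⟨s, rfl, rfl⟩
      simp [ModelPolygon.sideMap, ModelPolygon.sideStart, AffineMap.lineMap_apply_one_sub]
  · constructor
    · rintro rfl
      exact ⟨y.re, rfl, hre.symm⟩
    · rintro ⟨s, rfl, rfl⟩
      rfl

theorem glue_iff {a b : K.PreRealization} :
    K.Glue a b ↔ ∃ ρ : K.Incidence, ρ.IsFacet ∧ ρ.host = a.1 ∧ ρ.cell = b.1 ∧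
      (a.2 : ℂ) = ρ.embed b.2 := by
  constructor
  · rintro (⟨e, x, y, hx⟩ | ⟨e, x, y, hx⟩ | ⟨t, i, s, x, y, hx, hy⟩ | ⟨l, i, s, x, y, hx, hy⟩)
    · exact ⟨endpoint (e, true), .endpoint _, rfl, rfl, hx⟩
    · exact ⟨endpoint (e, false), .endpoint _, rfl, rfl, hx⟩
    · exact ⟨side (.tri t) i, .side _ _, rfl, rfl,
        (eq_sideMap_iff trianglePolygon i _ (Cell.mem_shape_edge.1 y.2).2).2 ⟨s, hx, hy⟩⟩
    · exact ⟨side (.loz l) i, .side _ _, rfl, rfl,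
        (eq_sideMap_iff lozengePolygon i _ (Cell.mem_shape_edge.1 y.2).2).2 ⟨s, hx, hy⟩⟩
  · obtain ⟨c, x⟩ := a
    obtain ⟨d, y⟩ := b
    rintro ⟨ρ, ⟨e, _ | _⟩ | ⟨F, i⟩, rfl, rfl, hx⟩
    · exact .tgt e x y hx
    · exact .src e x y hx
    · obtain ⟨s, hx, hy⟩ := (eq_sideMap_iff _ i _ (Cell.mem_shape_edge.1 y.2).2).1 hx
      cases F with
      | tri t => exact .tri t i s x y hx hy
      | loz l => exact .loz l i s x y hx hy

/-- The open star of a closed cell, before gluing. -/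
def preStar (c : K.Cell) : Set K.PreRealization :=
  {a | ∃ ρ : K.Incidence, ρ.host = a.1 ∧ ρ.cell = c ∧ (a.2 : ℂ) ∈ ρ.region}

theorem isOpen_preStar (c : K.Cell) : IsOpen (preStar c) := by
  refine isOpen_sigma_iff.2 fun d => ?_
  have h : IsOpen (⋃ ρ : {ρ : K.Incidence // ρ.host = d ∧ ρ.cell = c}, ρ.1.region) :=
    isOpen_iUnion fun ρ => ρ.1.isOpen_region
  convert h.preimage (continuous_subtype_val (p := (· ∈ d.shape))) using 1
  ext z
  simp [preStar, and_assoc]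

theorem mem_preStar_iff_of_glue {a b : K.PreRealization} (h : K.Glue a b) (c : K.Cell) :
    a ∈ preStar c ↔ b ∈ preStar c := by
  obtain ⟨d, x⟩ := a
  obtain ⟨d', y⟩ := b
  obtain ⟨ρ₀, hρ₀, rfl, rfl, hx⟩ := glue_iff.1 h
  constructor
  · rintro ⟨ρ', hhost, rfl, hρ'⟩
    obtain ⟨ρ, hρ, hcell, hy, -⟩ := exists_factor hρ₀ hhost y.2 (hx ▸ hρ')
    exact ⟨ρ, hρ, hcell, hy⟩
  · rintro ⟨ρ, hhost, rfl, hρ⟩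
    obtain ⟨ρ', hρ', hcell, hy⟩ := exists_comp hρ₀ hhost hρ
    exact ⟨ρ', hρ', hcell, hx ▸ hy⟩

/-- The open star of a closed cell. -/
def openStar (c : K.Cell) : Set K.Realization :=
  {x | Quot.liftOn x (· ∈ preStar c) fun _ _ h => propext (mem_preStar_iff_of_glue h c)}

theorem mk_mem_openStar {a : K.PreRealization} {c : K.Cell} :
    (Quot.mk _ a : K.Realization) ∈ openStar c ↔ a ∈ preStar c := Iff.rfl

theorem isOpen_openStar (c : K.Cell) : IsOpen (openStar c) :=
  isQuotientMap_quot_mk.isOpen_preimage.1 (isOpen_preStar c)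

theorem exists_mem_openStar (x : K.Realization) : ∃ c, x ∈ openStar c := by
  obtain ⟨⟨d, x⟩, rfl⟩ := Quot.exists_rep x
  obtain ⟨ρ, rfl, hρ⟩ := exists_mem_region x.2
  exact ⟨ρ.cell, ρ, rfl, rfl, hρ⟩

theorem disjoint_openStar {c c' : K.Cell} (hdim : c.dim = c'.dim) (hne : c ≠ c') :
    Disjoint (openStar c) (openStar c') := by
  refine Set.disjoint_left.2 fun x hx hx' => hne ?_
  induction x using Quot.ind with | mk a
  obtain ⟨ρ, hhost, rfl, h⟩ := hx
  obtain ⟨ρ', hhost', rfl, h'⟩ := hx'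
  have ha : (a.2 : ℂ) ∈ ρ.host.shape := by rw [hhost]; exact a.2.2
  exact congrArg cell (eq_of_mem_region (hhost.trans hhost'.symm) hdim ha h h')

end LozengeComplex

/-! ### Covering maps from combinatorial maps -/

open Set in
theorem isCoveringMap_of_sheets {E B C D : Type*} [TopologicalSpace E] [TopologicalSpace B]
    {p : E → B} (hcont : Continuous p) (hopen : IsOpenMap p) (hsurj : Function.Surjective p)
    {f : C → D} {U : C → Set E} {V : D → Set B} (hU : ∀ c, IsOpen (U c)) (hV : ∀ d, IsOpen (V d))
    (cover : ∀ b, ∃ d, b ∈ V d) (bijOn : ∀ c, BijOn p (U c) (V (f c)))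
    (disjoint : ∀ c c', f c = f c' → c ≠ c' → Disjoint (U c) (U c'))
    (exhaustive : ∀ d, p ⁻¹' V d ⊆ ⋃ c : {c // f c = d}, U c) : IsCoveringMap p := by
  intro b
  obtain ⟨d, hd⟩ := cover b
  obtain ⟨e, rfl⟩ := hsurj b
  obtain ⟨c, -⟩ := mem_iUnion.1 (exhaustive d hd)
  have : Nonempty {c // f c = d} := ⟨c⟩
  have : Nonempty (B → E) := ⟨fun _ => e⟩
  let _ : TopologicalSpace {c // f c = d} := ⊥
  have : DiscreteTopology {c // f c = d} := ⟨rfl⟩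
  have bij : ∀ c : {c // f c = d}, BijOn p (U c) (V d) := by
    intro c
    have h := bijOn c
    rwa [c.2] at h
  refine (IsEvenlyCovered.of_trivialization (t := (hV d).trivializationDiscrete
    (fun c : {c // f c = d} => U c) (V d) (fun c W hW => ⟨fun h => ?_, fun h => ?_⟩)
    (fun c => (bij c).injOn) (fun c => (bij c).surjOn) (fun c c' hc => ?_) (exhaustive d))
    hd).to_isEvenlyCovered_preimage
  · exact (h.preimage hcont).inter (hU c)
  · have himage : p '' (p ⁻¹' W ∩ U c) = W := by
      rw [image_preimage_inter, inter_eq_left, (bij c).image_eq]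
      exact hW
    exact himage ▸ hopen _ h
  · exact disjoint c c' (c.2.trans c'.2.symm) fun h => hc (Subtype.ext h)

namespace LozengeComplex

open Incidence Set

/-- A combinatorial map between complexes, sending edges to edges, triangles to triangles and
lozenges to lozenges. The edge `e` is mapped to `edge e` backwards if `flip e` holds, and the face
`F` is mapped to `face F` by the isometry `iso F` of the models. -/
structure Hom (K L : LozengeComplex) where
  vert : K.Vert → L.Vert
  edge : K.Edge → L.Edge
  flip : K.Edge → Bool
  face : K.Face → L.Face
  iso (F : K.Face) : PolygonIso F.polygon (face F).polygon
  start_edge : ∀ e b, L.start (edge e, flip e ^^ b) = vert (K.start (e, b))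
  side_face : ∀ F i, (face F).side ((iso F).side i) =
    (edge (F.side i).1, flip (F.side i).1 ^^ ((iso F).reversed ^^ (F.side i).2))

namespace Hom

variable {K L : LozengeComplex} (φ : Hom K L)

/-- The effect of a map on oriented edges. -/
def mapSide (s : K.Edge × Bool) : L.Edge × Bool := (φ.edge s.1, φ.flip s.1 ^^ s.2)

theorem start_mapSide (s : K.Edge × Bool) : L.start (φ.mapSide s) = φ.vert (K.start s) :=
  φ.start_edge s.1 s.2

/-- The effect of a map on closed cells. -/
def cellMap : K.Cell → L.Cell
  | .vert v => .vert (φ.vert v)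
  | .edge e => .edge (φ.edge e)
  | .tri t => (φ.face (.tri t)).cell
  | .loz l => (φ.face (.loz l)).cell

theorem cellMap_cell (F : K.Face) : φ.cellMap F.cell = (φ.face F).cell := by
  cases F <;> rfl

theorem dim_cellMap (c : K.Cell) : (φ.cellMap c).dim = c.dim := by
  induction c using Cell.faceCases with
  | vert v => rfl
  | edge e => rfl
  | face F => rw [cellMap_cell, Cell.dim_cell, Cell.dim_cell]

/-- The isometry of the plane which maps the model of a closed cell to the model of its image. -/
noncomputable def placement : K.Cell → ℂ ≃ᵃⁱ[ℝ] ℂ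
  | .vert _ => .refl ℝ ℂ
  | .edge e => bif φ.flip e then .constVSub ℝ 1 else .refl ℝ ℂ
  | .tri t => (φ.iso (.tri t)).toIso
  | .loz l => (φ.iso (.loz l)).toIso

theorem placement_edge (e : K.Edge) (z : ℂ) :
    φ.placement (.edge e) z = bif φ.flip e then 1 - z else z := by
  rw [placement]
  cases φ.flip e <;> rfl

theorem placement_cell (F : K.Face) : φ.placement F.cell = (φ.iso F).toIso := by
  cases F <;> rfl

theorem image_shape (c : K.Cell) : φ.placement c '' c.shape = (φ.cellMap c).shape := by
  induction c using Cell.faceCases with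
  | vert v => exact image_id _
  | edge e =>
    change φ.placement (.edge e) '' segment ℝ 0 1 = segment ℝ 0 1
    have h := image_segment ℝ (φ.placement (.edge e)).toAffineEquiv.toAffineMap 0 1
    refine h.trans ?_
    change segment ℝ (φ.placement (.edge e) 0) (φ.placement (.edge e) 1) = _
    rw [placement_edge, placement_edge]
    cases φ.flip e
    · rfl
    · rw [cond_true, cond_true, sub_zero, sub_self, segment_symm]
  | face F =>
    rw [placement_cell, cellMap_cell, Face.shape_cell, Face.shape_cell, PolygonIso.image_shape]

/-- The effect of a map on incidences. -/
noncomputable def incMap : K.Incidence → L.Incidence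
  | .vert v => .vert (φ.vert v)
  | .endpoint s => .endpoint (φ.mapSide s)
  | .edge e => .edge (φ.edge e)
  | .corner F i => .corner (φ.face F) ((φ.iso F).cornerMap i)
  | .side F i => .side (φ.face F) ((φ.iso F).side i)
  | .face F => .face (φ.face F)

theorem host_incMap (ρ : K.Incidence) : (φ.incMap ρ).host = φ.cellMap ρ.host := by
  cases ρ <;> first | rfl | exact (φ.cellMap_cell _).symm

/-- Side `i` of the face `F`, traversed in the direction whose image is the direction of travel
around the face `face F`. -/
def directedSide (F : K.Face) (i : Fin F.card) : K.Edge × Bool :=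
  ((F.side i).1, (φ.iso F).reversed ^^ (F.side i).2)

theorem mapSide_directedSide (F : K.Face) (i : Fin F.card) :
    φ.mapSide (φ.directedSide F i) = (φ.face F).side ((φ.iso F).side i) :=
  (φ.side_face F i).symm

theorem start_directedSide (F : K.Face) (i : Fin F.card) :
    K.start (φ.directedSide F i) =
      K.start (F.side (ModelPolygon.sideStart i !(φ.iso F).reversed)) := by
  rw [Face.start_side_sideStart, Bool.not_xor, Bool.not_not]
  rfl

theorem exists_side_of_corner (F : K.Face) (j : Fin F.card) :
    ∃ i, (φ.iso F).side i = (φ.iso F).cornerMap j ∧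
      K.start (φ.directedSide F i) = K.start (F.side j) := by
  obtain ⟨i, rfl⟩ := ModelPolygon.exists_eq_sideStart j !(φ.iso F).reversed
  exact ⟨i, ((φ.iso F).cornerMap_sideStart_not_reversed i).symm, φ.start_directedSide F i⟩

theorem cell_incMap (ρ : K.Incidence) : (φ.incMap ρ).cell = φ.cellMap ρ.cell := by
  cases ρ with
  | vert v => rfl
  | endpoint s => exact congrArg _ (φ.start_mapSide s)
  | edge e => rfl
  | corner F j =>
    obtain ⟨i, hi, hstart⟩ := φ.exists_side_of_corner F j
    refine congrArg Cell.vert ?_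
    rw [← hi, ← mapSide_directedSide, start_mapSide, hstart]
  | side F i => exact congrArg _ (congrArg Prod.fst (φ.side_face F i))
  | face F => exact (φ.cellMap_cell F).symm

theorem embed_incMap (ρ : K.Incidence) (z : ℂ) :
    (φ.incMap ρ).embed (φ.placement ρ.cell z) = φ.placement ρ.host (ρ.embed z) := by
  cases ρ with
  | vert v => rfl
  | endpoint s =>
    obtain ⟨e, b⟩ := s
    change (bif φ.flip e ^^ b then (0 : ℂ) else 1) =
      φ.placement (.edge e) (bif b then (0 : ℂ) else 1)
    rw [placement_edge]
    cases b <;> cases φ.flip e <;> simp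
  | edge e => rfl
  | corner F i =>
    rw [host, placement_cell]
    exact ((φ.iso F).map_corner i).symm
  | side F i =>
    change (φ.face F).polygon.sideMap ((φ.iso F).side i) ((φ.face F).side ((φ.iso F).side i)).2
      (φ.placement (.edge (F.side i).1) z).re = φ.placement F.cell (F.polygon.sideMap i _ z.re)
    rw [placement_cell, PolygonIso.sideMap_toIso, side_face, placement_edge]
    cases φ.flip (F.side i).1
    · rw [Bool.false_xor, cond_false]
    · rw [Bool.true_xor, cond_true, ModelPolygon.sideMap_not]
      simp
  | face F => rfl

theorem mem_region_incMap (ρ : K.Incidence) {z : ℂ} :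
    φ.placement ρ.host z ∈ (φ.incMap ρ).region ↔ z ∈ ρ.region := by
  cases ρ with
  | vert v => rfl
  | endpoint s =>
    obtain ⟨e, b⟩ := s
    change (bif φ.flip e ^^ b then (φ.placement (.edge e) z).re else
      1 - (φ.placement (.edge e) z).re) < 1 / 2 ↔ (bif b then z.re else 1 - z.re) < 1 / 2
    rw [placement_edge]
    cases b <;> cases φ.flip e <;> simp
  | edge e =>
    change 0 < (φ.placement (.edge e) z).re ∧ (φ.placement (.edge e) z).re < 1 ↔
      0 < z.re ∧ z.re < 1
    rw [placement_edge]
    cases φ.flip e <;> simp [and_comm]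
  | corner F i =>
    rw [host, placement_cell]
    exact (φ.iso F).nearCorner_toIso
  | side F i =>
    rw [host, placement_cell]
    exact (φ.iso F).nearSide_toIso
  | face F =>
    rw [host, placement_cell]
    exact (φ.iso F).inside_toIso

theorem isFacet_incMap {ρ : K.Incidence} : (φ.incMap ρ).IsFacet ↔ ρ.IsFacet := by
  cases ρ <;> constructor <;> intro h <;> first | constructor | cases h

theorem exists_incMap_eq {c : K.Cell} {ρ' : L.Incidence} (h : ρ'.host = φ.cellMap c) :
    ∃ ρ, φ.incMap ρ = ρ' ∧ ρ.host = c := by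
  induction c using Cell.faceCases with
  | vert v =>
    cases ρ' <;> simp only [host, cellMap, Cell.vert.injEq, Face.cell_ne_vert, reduceCtorEq] at h
    exact ⟨.vert v, by rw [h]; rfl, rfl⟩
  | edge e =>
    cases ρ' <;> simp only [host, cellMap, Cell.edge.injEq, Face.cell_ne_edge, reduceCtorEq] at h
    · rename_i s
      obtain ⟨e', b⟩ := s
      obtain rfl : e' = φ.edge e := h
      refine ⟨.endpoint (e, φ.flip e ^^ b), ?_, rfl⟩
      rw [incMap, mapSide, ← Bool.xor_assoc, Bool.xor_self, Bool.false_xor]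
    · exact ⟨.edge e, by rw [h]; rfl, rfl⟩
  | face F =>
    rw [cellMap_cell] at h
    cases ρ' <;> simp only [host, Face.cell_injective.eq_iff, (Face.cell_ne_edge _ _).symm,
      (Face.cell_ne_vert _ _).symm] at h <;> subst h
    · rename_i k
      obtain ⟨i, rfl⟩ := (φ.iso F).cornerMap_surjective k
      exact ⟨.corner F i, rfl, rfl⟩
    · rename_i k
      obtain ⟨i, rfl⟩ := (φ.iso F).side.surjective k
      exact ⟨.side F i, rfl, rfl⟩
    · exact ⟨.face F, rfl, rfl⟩

end Hom
end LozengeComplex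

namespace LozengeComplex.Hom

open Incidence Set

variable {K L : LozengeComplex} {φ : Hom K L}

/-- A map of complexes is a covering if it is surjective and every incidence of codimension one
lifts uniquely to every cell above its `cell`. -/
structure IsCovering (φ : Hom K L) : Prop where
  cellMap_surjective : Function.Surjective φ.cellMap
  existsUnique_facet : ∀ c ρ', ρ'.IsFacet → ρ'.cell = φ.cellMap c →
    ∃! ρ, φ.incMap ρ = ρ' ∧ ρ.cell = c

namespace IsCovering

variable (h : φ.IsCovering)
include h

theorem facet_injective {ρ₁ ρ₂ : K.Incidence} (hρ : ρ₁.IsFacet) (hmap : φ.incMap ρ₁ = φ.incMap ρ₂)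
    (hcell : ρ₁.cell = ρ₂.cell) : ρ₁ = ρ₂ :=
  (h.existsUnique_facet ρ₁.cell _ (φ.isFacet_incMap.2 hρ) (φ.cell_incMap ρ₁)).unique ⟨rfl, rfl⟩
    ⟨hmap.symm, hcell.symm⟩

theorem mapSide_injective {s₁ s₂ : K.Edge × Bool} (hmap : φ.mapSide s₁ = φ.mapSide s₂)
    (hstart : K.start s₁ = K.start s₂) : s₁ = s₂ :=
  endpoint.inj (h.facet_injective (.endpoint s₁) (congrArg endpoint hmap)
    (congrArg Cell.vert hstart))

theorem corner_injective {F₁ F₂ : K.Face} {j₁ : Fin F₁.card} {j₂ : Fin F₂.card}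
    (hmap : φ.incMap (corner F₁ j₁) = φ.incMap (corner F₂ j₂))
    (hstart : K.start (F₁.side j₁) = K.start (F₂.side j₂)) : corner F₁ j₁ = corner F₂ j₂ := by
  obtain ⟨i₁, hi₁, hs₁⟩ := φ.exists_side_of_corner F₁ j₁
  obtain ⟨i₂, hi₂, hs₂⟩ := φ.exists_side_of_corner F₂ j₂
  have hside : φ.incMap (side F₁ i₁) = φ.incMap (side F₂ i₂) := by
    simp only [incMap, hi₁, hi₂]
    simpa only [incMap, corner.injEq, side.injEq] using hmap
  have hedge : φ.directedSide F₁ i₁ = φ.directedSide F₂ i₂ := by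
    refine h.mapSide_injective ?_ (hs₁.trans (hstart.trans hs₂.symm))
    rw [mapSide_directedSide, mapSide_directedSide]
    simp only [incMap, side.injEq] at hside
    congr 1 <;> simp only [hside]
  obtain ⟨rfl, hi⟩ := side.inj (h.facet_injective (.side F₁ i₁) hside
    (congrArg (fun s => Cell.edge s.1) hedge :))
  obtain rfl := eq_of_heq hi
  rw [(φ.iso F₁).cornerMap_injective (hi₁.symm.trans hi₂)]

theorem incMap_injective {ρ₁ ρ₂ : K.Incidence} (hmap : φ.incMap ρ₁ = φ.incMap ρ₂)
    (hcell : ρ₁.cell = ρ₂.cell) : ρ₁ = ρ₂ := by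
  cases ρ₁ <;> cases ρ₂ <;> try cases hmap
  · exact congrArg _ (Cell.vert.inj hcell)
  · exact h.facet_injective (.endpoint _) hmap hcell
  · exact congrArg _ (Cell.edge.inj hcell)
  · exact h.corner_injective hmap (Cell.vert.inj hcell)
  · exact h.facet_injective (.side _ _) hmap hcell
  · exact congrArg _ (Face.cell_injective hcell)

theorem exists_mapSide_eq {v : K.Vert} {s' : L.Edge × Bool} (hs' : L.start s' = φ.vert v) :
    ∃ s, φ.mapSide s = s' ∧ K.start s = v := by
  obtain ⟨ρ, ⟨hmap, hcell⟩, -⟩ :=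
    h.existsUnique_facet (.vert v) (endpoint s') (.endpoint _) (congrArg Cell.vert hs')
  cases ρ <;> simp only [incMap, reduceCtorEq, endpoint.injEq] at hmap
  exact ⟨_, hmap, Cell.vert.inj hcell⟩

theorem exists_face_eq {e : K.Edge} {F' : L.Face} {k : Fin F'.card}
    (hk : (F'.side k).1 = φ.edge e) :
    ∃ F i, φ.incMap (side F i) = side F' k ∧ (F.side i).1 = e := by
  obtain ⟨ρ, ⟨hmap, hcell⟩, -⟩ :=
    h.existsUnique_facet (.edge e) (side F' k) (.side _ _) (congrArg Cell.edge hk)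
  cases ρ <;> simp only [incMap, reduceCtorEq] at hmap
  exact ⟨_, _, hmap, Cell.edge.inj hcell⟩

theorem exists_corner_eq {v : K.Vert} {F' : L.Face} {k : Fin F'.card}
    (hk : L.start (F'.side k) = φ.vert v) :
    ∃ ρ, φ.incMap ρ = corner F' k ∧ ρ.cell = .vert v := by
  obtain ⟨s, hs, rfl⟩ := h.exists_mapSide_eq hk
  obtain ⟨F, i, hmap, hi⟩ := h.exists_face_eq (congrArg Prod.fst hs).symm
  obtain ⟨rfl, hk⟩ := side.inj hmap
  obtain rfl := eq_of_heq hk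
  have hdir : φ.directedSide F i = s := by
    rw [← φ.mapSide_directedSide] at hs
    refine Prod.ext hi ?_
    have hflip := congrArg Prod.snd hs
    simp only [mapSide, directedSide, hi, Bool.xor_right_inj] at hflip
    exact hflip.symm
  refine ⟨corner F (ModelPolygon.sideStart i !(φ.iso F).reversed), ?_, ?_⟩
  · rw [incMap, PolygonIso.cornerMap_sideStart_not_reversed]
  · rw [cell, ← start_directedSide, hdir]

theorem exists_incMap_eq_of_cell {c : K.Cell} {ρ' : L.Incidence} (hρ' : ρ'.cell = φ.cellMap c) :
    ∃ ρ, φ.incMap ρ = ρ' ∧ ρ.cell = c := by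
  have hdim : ρ'.cell.dim = c.dim := by rw [hρ', dim_cellMap]
  cases ρ' with
  | endpoint s => exact (h.existsUnique_facet c _ (.endpoint s) hρ').exists
  | side F i => exact (h.existsUnique_facet c _ (.side F i) hρ').exists
  | corner F k =>
    cases c <;> cases hdim
    exact h.exists_corner_eq (Cell.vert.inj hρ')
  | vert v =>
    cases c <;> cases hdim
    exact ⟨.vert _, congrArg _ (Cell.vert.inj hρ').symm, rfl⟩
  | edge e =>
    cases c <;> cases hdim
    exact ⟨.edge _, congrArg _ (Cell.edge.inj hρ').symm, rfl⟩
  | face F =>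
    induction c using Cell.faceCases with
    | vert v => cases F <;> cases hdim
    | edge e => cases F <;> cases hdim
    | face F₀ =>
      rw [cellMap_cell] at hρ'
      exact ⟨.face F₀, congrArg _ (Face.cell_injective hρ').symm, rfl⟩

end IsCovering

variable (φ)

/-- The effect of a map on points, before gluing. -/
noncomputable def preMap (a : K.PreRealization) : L.PreRealization :=
  ⟨φ.cellMap a.1, φ.placement a.1 a.2, φ.image_shape a.1 ▸ mem_image_of_mem _ a.2.2⟩

/-- The restriction of the placement of a closed cell to its model. -/
noncomputable def cellIso (c : K.Cell) : c.shape ≃ᵢ (φ.cellMap c).shape where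
  toFun x := (φ.preMap ⟨c, x⟩).2
  invFun y := ⟨(φ.placement c).symm y, by
    obtain ⟨x, hx, hxy⟩ := (φ.image_shape c).symm.subset y.2
    rwa [← hxy, AffineIsometryEquiv.symm_apply_apply]⟩
  left_inv x := Subtype.ext ((φ.placement c).symm_apply_apply x)
  right_inv y := Subtype.ext ((φ.placement c).apply_symm_apply y)
  isometry_toFun := fun x y => (φ.placement c).isometry x y

theorem continuous_preMap : Continuous φ.preMap :=
  continuous_sigma fun c => (continuous_sigmaMk (σ := fun d : L.Cell => d.shape)).comp
    (φ.cellIso c).continuous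

theorem isOpenMap_preMap : IsOpenMap φ.preMap :=
  isOpenMap_sigma.2 fun c =>
    (isOpenMap_sigmaMk (σ := fun d : L.Cell => d.shape)).comp (φ.cellIso c).toHomeomorph.isOpenMap

theorem glue_preMap {a b : K.PreRealization} (h : K.Glue a b) :
    L.Glue (φ.preMap a) (φ.preMap b) := by
  obtain ⟨c, x⟩ := a
  obtain ⟨d, y⟩ := b
  obtain ⟨ρ, hρ, rfl, rfl, hx⟩ := glue_iff.1 h
  refine glue_iff.2 ⟨φ.incMap ρ, φ.isFacet_incMap.2 hρ, φ.host_incMap ρ, φ.cell_incMap ρ, ?_⟩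
  exact (congrArg _ hx).trans (φ.embed_incMap ρ y).symm

theorem exists_glue_of_glue_preMap {a : K.PreRealization} {b' : L.PreRealization}
    (h : L.Glue (φ.preMap a) b') : ∃ b, K.Glue a b ∧ φ.preMap b = b' := by
  obtain ⟨ρ', hρ', hhost', hcell, hx⟩ := glue_iff.1 h
  obtain ⟨ρ, rfl, hhost⟩ := φ.exists_incMap_eq hhost'
  obtain ⟨c, z⟩ := a
  obtain rfl : ρ.host = c := hhost
  obtain ⟨d, y⟩ := b'
  obtain rfl : φ.cellMap ρ.cell = d := (φ.cell_incMap ρ).symm.trans hcell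
  obtain ⟨x, rfl⟩ := (φ.cellIso ρ.cell).surjective y
  refine ⟨⟨ρ.cell, x⟩, glue_iff.2 ⟨ρ, φ.isFacet_incMap.1 hρ', rfl, rfl, ?_⟩, rfl⟩
  exact (φ.placement ρ.host).injective (hx.trans (φ.embed_incMap ρ x))

/-- The continuous map of spaces induced by a map of complexes. -/
noncomputable def realization : K.Realization → L.Realization :=
  Quot.map φ.preMap fun _ _ => φ.glue_preMap

theorem continuous_realization : Continuous φ.realization :=
  continuous_quot_lift _ (continuous_quot_mk.comp φ.continuous_preMap)

theorem isCellwiseIsometric_realization : IsCellwiseIsometric φ.realization :=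
  fun c => ⟨φ.cellMap c, φ.cellIso c, fun _ => rfl⟩

theorem preMap_mem_preStar {a : K.PreRealization} {d : L.Cell} :
    φ.preMap a ∈ preStar d ↔ ∃ c, φ.cellMap c = d ∧ a ∈ preStar c := by
  constructor
  · rintro ⟨ρ', hhost', rfl, hx⟩
    obtain ⟨ρ, rfl, hhost⟩ := φ.exists_incMap_eq hhost'
    refine ⟨ρ.cell, (φ.cell_incMap ρ).symm, ρ, hhost, rfl, (φ.mem_region_incMap ρ).1 ?_⟩
    rw [hhost]
    exact hx
  · rintro ⟨c, rfl, ρ, hhost, rfl, hx⟩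
    refine ⟨φ.incMap ρ, (φ.host_incMap ρ).trans (congrArg _ hhost), φ.cell_incMap ρ, ?_⟩
    have hx' := (φ.mem_region_incMap ρ).2 hx
    rwa [hhost] at hx'

variable {φ}

namespace IsCovering

variable (h : φ.IsCovering)
include h

theorem exists_preMap_eq {c : K.Cell} {b : L.PreRealization} (hb : b ∈ preStar (φ.cellMap c)) :
    ∃ a ∈ preStar c, φ.preMap a = b := by
  obtain ⟨d, y⟩ := b
  obtain ⟨ρ', hhost, hcell, hy⟩ := hb
  obtain ⟨ρ, rfl, rfl⟩ := h.exists_incMap_eq_of_cell hcell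
  obtain rfl : φ.cellMap ρ.host = d := (φ.host_incMap ρ).symm.trans hhost
  obtain ⟨x, rfl⟩ := (φ.cellIso ρ.host).surjective y
  exact ⟨⟨ρ.host, x⟩, ⟨ρ, rfl, rfl, (φ.mem_region_incMap ρ).1 hy⟩, rfl⟩

theorem injOn_preMap (c : K.Cell) : InjOn φ.preMap (preStar c) := by
  rintro ⟨d₁, x₁⟩ ⟨ρ₁, rfl, rfl, hx₁⟩ ⟨d₂, x₂⟩ ⟨ρ₂, rfl, hcell, hx₂⟩ hxx
  have hhost : φ.cellMap ρ₁.host = φ.cellMap ρ₂.host := congrArg Sigma.fst hxx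
  have hval : φ.placement ρ₁.host x₁ = φ.placement ρ₂.host x₂ :=
    congrArg (fun a : L.PreRealization => (a.2 : ℂ)) hxx
  have hρ : φ.incMap ρ₁ = φ.incMap ρ₂ := by
    refine eq_of_mem_region (z := φ.placement ρ₁.host x₁) ?_ ?_ ?_ ?_ ?_
    · rw [host_incMap, host_incMap, hhost]
    · rw [cell_incMap, cell_incMap, hcell]
    · rw [host_incMap]
      exact (φ.cellIso ρ₁.host x₁).2
    · exact (φ.mem_region_incMap ρ₁).2 hx₁
    · rw [hval]
      exact (φ.mem_region_incMap ρ₂).2 hx₂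
  obtain rfl : ρ₁ = ρ₂ := h.incMap_injective hρ hcell.symm
  exact PreRealization.ext rfl ((φ.placement ρ₁.host).injective hval)

/-- A chain of gluings downstairs is lifted step by step inside an open star upstairs. -/
theorem mk_eq_of_eqvGen {c : K.Cell} {b b' : L.PreRealization} (hbb : Relation.EqvGen L.Glue b b')
    (hb : b ∈ preStar (φ.cellMap c)) {a a' : K.PreRealization} (ha : a ∈ preStar c)
    (ha' : a' ∈ preStar c) (hab : φ.preMap a = b) (hab' : φ.preMap a' = b') :
    (Quot.mk K.Glue a : K.Realization) = Quot.mk K.Glue a' := by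
  induction hbb generalizing a a' with
  | rel b b' hglue =>
    subst hab
    obtain ⟨a'', hglue', rfl⟩ := φ.exists_glue_of_glue_preMap hglue
    rw [h.injOn_preMap c ha' ((mem_preStar_iff_of_glue hglue' c).1 ha) hab']
    exact Quot.sound hglue'
  | refl b => rw [h.injOn_preMap c ha ha' (hab.trans hab'.symm)]
  | symm b b' _ ih =>
    exact (ih (hab' ▸ φ.preMap_mem_preStar.2 ⟨c, rfl, ha'⟩) ha' ha hab' hab).symm
  | trans b b' b'' hbb _ ih ih' =>
    have hb' : b' ∈ preStar (φ.cellMap c) :=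
      mk_mem_openStar.1 (Quot.eqvGen_sound hbb ▸ mk_mem_openStar.2 hb)
    obtain ⟨x, hx, hxb⟩ := h.exists_preMap_eq hb'
    exact (ih hb ha hx hab hxb).trans (ih' hb' hx ha' hxb hab')

theorem bijOn_openStar (c : K.Cell) :
    BijOn φ.realization (openStar c) (openStar (φ.cellMap c)) := by
  refine ⟨?_, ?_, ?_⟩
  · rintro ⟨a⟩ ha
    exact φ.preMap_mem_preStar.2 ⟨c, rfl, ha⟩
  · rintro ⟨a⟩ ha ⟨a'⟩ ha' haa
    exact h.mk_eq_of_eqvGen (Quot.eqvGen_exact haa) (φ.preMap_mem_preStar.2 ⟨c, rfl, ha⟩) ha ha'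
      rfl rfl
  · rintro ⟨b⟩ hb
    obtain ⟨a, ha, rfl⟩ := h.exists_preMap_eq hb
    exact ⟨Quot.mk _ a, ha, rfl⟩

theorem isOpenMap_realization : IsOpenMap φ.realization := by
  intro O hO
  refine isQuotientMap_quot_mk.isOpen_preimage.1 ?_
  convert φ.isOpenMap_preMap _ (hO.preimage continuous_quot_mk) using 1
  ext b
  constructor
  · rintro ⟨x, hx, hxb⟩
    obtain ⟨c, hc⟩ := exists_mem_openStar x
    have hb : b ∈ preStar (φ.cellMap c) := mk_mem_openStar.1 (hxb ▸ (h.bijOn_openStar c).mapsTo hc)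
    obtain ⟨a, ha, rfl⟩ := h.exists_preMap_eq hb
    have hxa : x = Quot.mk _ a := (h.bijOn_openStar c).injOn hc (mk_mem_openStar.2 ha) hxb
    exact ⟨a, mem_preimage.2 (hxa ▸ hx), rfl⟩
  · rintro ⟨a, ha, rfl⟩
    exact ⟨_, ha, rfl⟩

theorem surjective_realization : Function.Surjective φ.realization := by
  rintro ⟨d, y⟩
  obtain ⟨c, rfl⟩ := h.cellMap_surjective d
  obtain ⟨x, rfl⟩ := (φ.cellIso c).surjective y
  exact ⟨Quot.mk _ ⟨c, x⟩, rfl⟩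

theorem isCoveringMap_realization : IsCoveringMap φ.realization := by
  refine isCoveringMap_of_sheets φ.continuous_realization h.isOpenMap_realization
    h.surjective_realization isOpen_openStar isOpen_openStar exists_mem_openStar h.bijOn_openStar
    (fun c c' hcc hne => disjoint_openStar ?_ hne) ?_
  · rw [← φ.dim_cellMap, hcc, φ.dim_cellMap]
  · rintro d ⟨a⟩ ha
    obtain ⟨c, hc, hac⟩ := φ.preMap_mem_preStar.1 ha
    exact mem_iUnion.2 ⟨⟨c, hc⟩, hac⟩

end IsCovering

end LozengeComplex.Hom

/-! ### Homotopy invariants of paths and flat labellings of edges -/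

/-- An assignment of group elements to paths which is multiplicative and invariant under
homotopies relative to the endpoints. -/
structure PathCharacter (X : Type*) [TopologicalSpace X] (π : Type*) [Group π] where
  toFun : ∀ {x y : X}, Path x y → π
  map_trans : ∀ {x y z : X} (γ : Path x y) (γ' : Path y z),
    toFun (γ.trans γ') = toFun γ * toFun γ'
  map_homotopic : ∀ {x y : X} (γ γ' : Path x y), γ.Homotopic γ' → toFun γ = toFun γ'

namespace PathCharacter

open scoped unitInterval Topology

variable {X Y π : Type*} [TopologicalSpace X] [TopologicalSpace Y] [Group π]

/-- The pull-back of a path character. -/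
def comap (χ : PathCharacter X π) {f : Y → X} (hf : Continuous f) : PathCharacter Y π where
  toFun γ := χ.toFun (γ.map hf)
  map_trans γ γ' := by rw [Path.map_trans, χ.map_trans]
  map_homotopic γ γ' h := χ.map_homotopic _ _ (h.map ⟨f, hf⟩)

/-- A function whose increment along each path is the value of the path character. -/
def IsPrimitive (χ : PathCharacter X π) (u : X → π) : Prop :=
  ∀ ⦃x y⦄ (γ : Path x y), u y = u x * χ.toFun γ

variable (χ : PathCharacter X π)

theorem map_refl (x : X) : χ.toFun (Path.refl x) = 1 := by
  have h := χ.map_trans (Path.refl x) (Path.refl x)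
  rw [Path.refl_trans_refl] at h
  exact left_eq_mul.1 h

theorem congr {x y x' y' : X} {γ : Path x y} {γ' : Path x' y'} (h : ∀ t, γ t = γ' t) :
    χ.toFun γ = χ.toFun γ' := by
  obtain rfl : x = x' := by simpa using h 0
  obtain rfl : y = y' := by simpa using h 1
  obtain rfl : γ = γ' := Path.ext (funext h)
  rfl

theorem eq_of_simplyConnected [SimplyConnectedSpace X] {x y : X} (γ γ' : Path x y) :
    χ.toFun γ = χ.toFun γ' :=
  χ.map_homotopic _ _ (SimplyConnectedSpace.paths_homotopic γ γ')

theorem mul_eq_mul_of_square {G : I × I → X} (hG : Continuous G) {a b c d : X} (bot : Path a b)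
    (top : Path c d) (left : Path a c) (right : Path b d) (hbot : ∀ t, bot t = G (t, 0))
    (htop : ∀ t, top t = G (t, 1)) (hleft : ∀ t, left t = G (0, t))
    (hright : ∀ t, right t = G (1, t)) :
    χ.toFun bot * χ.toFun right = χ.toFun left * χ.toFun top := by
  have : ContractibleSpace I := (convex_Icc (0 : ℝ) 1).contractibleSpace ⟨0, by simp⟩
  let p : Path (0 : I) 1 := ⟨ContinuousMap.id I, rfl, rfl⟩
  have h := (χ.comap hG).eq_of_simplyConnected
    ((p.prod (Path.refl 0)).trans ((Path.refl 1).prod p))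
    (((Path.refl 0).prod p).trans (p.prod (Path.refl 1)))
  rw [map_trans, map_trans] at h
  have ebot : (χ.comap hG).toFun (p.prod (Path.refl 0)) = χ.toFun bot :=
    χ.congr fun t => (hbot t).symm
  have eright : (χ.comap hG).toFun ((Path.refl 1).prod p) = χ.toFun right :=
    χ.congr fun t => (hright t).symm
  have eleft : (χ.comap hG).toFun ((Path.refl 0).prod p) = χ.toFun left :=
    χ.congr fun t => (hleft t).symm
  have etop : (χ.comap hG).toFun (p.prod (Path.refl 1)) = χ.toFun top :=
    χ.congr fun t => (htop t).symm
  rwa [ebot, eright, eleft, etop] at h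

theorem isPrimitive_of_local {u : X → π}
    (h : ∀ x : X, ∃ U ∈ 𝓝 x, ∀ y z (γ : Path y z), (∀ t, γ t ∈ U) → u z = u y * χ.toFun γ) :
    χ.IsPrimitive u := by
  intro x y γ
  let w : I → π := fun t => u (γ t) * (χ.toFun (γ.subpath 0 t))⁻¹
  have hw : IsLocallyConstant w := by
    rw [IsLocallyConstant.iff_eventually_eq]
    intro t
    obtain ⟨U, hU, hprim⟩ := h (γ t)
    have hsmall : Filter.Tendsto (fun s : I => Set.uIcc t s) (𝓝 t) (𝓝 t).smallSets :=
      Filter.Tendsto.uIcc tendsto_const_nhds Filter.tendsto_id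
    filter_upwards [hsmall.eventually (Filter.eventually_smallSets_subset.2
      (γ.continuous.continuousAt.preimage_mem_nhds hU))] with s hs
    have hstep := hprim _ _ (γ.subpath t s) fun r => by
      obtain ⟨r', hr', heq⟩ : γ.subpath t s r ∈ γ '' Set.uIcc t s :=
        Path.range_subpath γ t s ▸ ⟨r, rfl⟩
      rw [← heq]
      exact hs hr'
    have hsub := χ.map_homotopic _ _ ⟨Path.Homotopy.subpathTransSubpath γ 0 t s⟩
    rw [χ.map_trans] at hsub
    simp only [w, ← hsub, hstep]
    group
  have hconst : w 1 = w 0 := hw.apply_eq_of_preconnectedSpace 1 0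
  have h0 : χ.toFun (γ.subpath 0 0) = 1 := by rw [Path.subpath_self, map_refl]
  have h1 : χ.toFun (γ.subpath 0 1) = χ.toFun γ := χ.congr fun t => by
    rw [Path.subpath_zero_one]
    rfl
  simp only [w, h0, h1, inv_one, mul_one, γ.source, γ.target] at hconst
  exact mul_inv_eq_iff_eq_mul.1 hconst

theorem eq_mul_of_contraction {u : X → π} {S : Set X} {H : X → C(I, X)}
    (hH : ContinuousOn H S) {q : X} (h0 : ∀ x, H x 0 = x) (h1 : ∀ x ∈ S, H x 1 = q)
    (hu : ∀ x ∈ S, ∀ γ : Path x q, (∀ t, γ t = H x t) → u q = u x * χ.toFun γ)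
    {y z : X} (γ : Path y z) (hγ : ∀ t, γ t ∈ S) : u z = u y * χ.toFun γ := by
  have hcont : Continuous fun t : I => H (γ t) := hH.comp_continuous γ.continuous hγ
  have hG : Continuous fun p : I × I => H (γ p.1) p.2 :=
    ContinuousMap.continuous_uncurry_of_continuous ⟨_, hcont⟩
  have hy : y ∈ S := by simpa using hγ 0
  have hz : z ∈ S := by simpa using hγ 1
  let left : Path y q := ⟨H y, h0 y, h1 y hy⟩
  let right : Path z q := ⟨H z, h0 z, h1 z hz⟩
  have hsquare := χ.mul_eq_mul_of_square hG γ (Path.refl q) left right (fun t => (h0 _).symm)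
    (fun t => (h1 _ (hγ t)).symm) (fun t => by simp [left]) (fun t => by simp [right])
  have hleft := hu y hy left fun _ => rfl
  have hright := hu z hz right fun _ => rfl
  rw [map_refl, mul_one] at hsquare
  rw [hleft, ← hsquare, ← mul_assoc] at hright
  exact (mul_right_cancel hright).symm

end PathCharacter

section Connecting

open Path.Homotopic.Quotient

variable {X : Type*} [TopologicalSpace X] {x : X} (T : ∀ y, Path x y)

/-- The path character which closes up each path to a loop at `x` by means of the paths `T`. Its
values are in the opposite group since multiplication in `FundamentalGroup` is composition of
automorphisms, that is, concatenation in reverse order. -/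
noncomputable def connectingCharacter : PathCharacter X (FundamentalGroup X x)ᵐᵒᵖ where
  toFun {y z} γ :=
    MulOpposite.op (FundamentalGroup.fromPath (mk (((T y).trans γ).trans (T z).symm)))
  map_trans {y z w} γ γ' := by
    rw [← MulOpposite.op_mul, FundamentalGroup.mul_def]
    congr 1
    change trans (trans (mk (T y)) (trans (mk γ) (mk γ'))) (symm (mk (T w))) =
      trans (trans (trans (mk (T y)) (mk γ)) (symm (mk (T z))))
        (trans (trans (mk (T z)) (mk γ')) (symm (mk (T w))))
    simp only [trans_assoc]
    rw [← trans_assoc (symm (mk (T z))), symm_trans, refl_trans]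
  map_homotopic γ γ' h := by
    congr 2
    exact Quotient.sound (((Path.Homotopic.refl _).hcomp h).hcomp (Path.Homotopic.refl _))

theorem homotopic_of_connectingCharacter_eq {y z : X} {γ γ' : Path y z}
    (h : (connectingCharacter T).toFun γ = (connectingCharacter T).toFun γ') : γ.Homotopic γ' := by
  have key (γ : Path y z) : mk γ = trans (symm (mk (T y)))
      (trans (trans (trans (mk (T y)) (mk γ)) (symm (mk (T z)))) (mk (T z))) := by
    rw [trans_assoc, trans_assoc, symm_trans, trans_refl, ← trans_assoc, symm_trans, refl_trans]
  have hloop : trans (trans (mk (T y)) (mk γ)) (symm (mk (T z))) =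
      trans (trans (mk (T y)) (mk γ')) (symm (mk (T z))) := MulOpposite.op_injective h
  exact Path.Homotopic.Quotient.exact (by rw [key γ, hloop, ← key γ'])

end Connecting

theorem simplyConnectedSpace_of_isPrimitive {X : Type*} [TopologicalSpace X]
    [PathConnectedSpace X] (h : ∀ (x : X) (χ : PathCharacter X (FundamentalGroup X x)ᵐᵒᵖ),
      ∃ u, χ.IsPrimitive u) : SimplyConnectedSpace X := by
  refine simply_connected_iff_loops_nullhomotopic.2 ⟨inferInstance, fun x γ => ?_⟩
  obtain ⟨u, hu⟩ := h x (connectingCharacter fun y => PathConnectedSpace.somePath x y)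
  refine homotopic_of_connectingCharacter_eq (fun y => PathConnectedSpace.somePath x y) ?_
  rw [PathCharacter.map_refl]
  exact left_eq_mul.1 (hu γ)

namespace LozengeComplex

open AffineMap Incidence

variable {K : LozengeComplex}

theorem continuous_charMap (c : K.Cell) : Continuous (charMap c) :=
  continuous_quot_mk.comp (continuous_sigmaMk (σ := fun c : K.Cell => c.shape))

namespace Cell

theorem convex_shape (c : K.Cell) : Convex ℝ c.shape := by
  induction c using faceCases with
  | vert _ => exact convex_singleton 0
  | edge _ => exact convex_segment 0 1
  | face F => exact F.shape_cell ▸ F.polygon.convex_shape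

theorem zero_mem_shape (c : K.Cell) : 0 ∈ c.shape := by
  cases c with
  | vert v => rfl
  | edge e => exact left_mem_segment ℝ _ _
  | tri t => exact subset_convexHull ℝ _ ⟨0, rfl⟩
  | loz l => exact subset_convexHull ℝ _ ⟨0, rfl⟩

/-- The point `0` of the model of a cell. It is a corner of the model, unless the cell is a
vertex. -/
def origin (c : K.Cell) : c.shape := ⟨0, c.zero_mem_shape⟩

/-- The vertex to which the point `0` of the model of a cell is glued. -/
def base : K.Cell → K.Vert
  | vert v => v
  | edge e => K.src e
  | tri t => K.start (K.triSide t 0)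
  | loz l => K.start (K.lozSide l 0)

theorem base_cell (F : K.Face) : F.cell.base = K.start (F.side 0) := by
  cases F <;> rfl

instance (c : K.Cell) : ContractibleSpace c.shape :=
  c.convex_shape.contractibleSpace ⟨0, c.zero_mem_shape⟩

/-- The straight path between two points of the model of a cell. -/
noncomputable def segment (c : K.Cell) (x y : c.shape) : Path x y where
  toFun t := ⟨lineMap (x : ℂ) (y : ℂ) (t : ℝ), c.convex_shape.lineMap_mem x.2 y.2 t.2⟩
  continuous_toFun := by
    refine Continuous.subtype_mk ?_ _
    simp only [lineMap_apply_module]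
    fun_prop
  source' := Subtype.ext (by simp)
  target' := Subtype.ext (by simp)

end Cell

namespace Incidence

theorem embed_mem_shape (ρ : K.Incidence) {z : ℂ} (hz : z ∈ ρ.cell.shape) :
    ρ.embed z ∈ ρ.host.shape := by
  cases ρ with
  | vert v => exact hz
  | endpoint s =>
    obtain ⟨e, _ | _⟩ := s
    · exact right_mem_segment ℝ _ _
    · exact left_mem_segment ℝ _ _
  | edge e => exact hz
  | corner F i => exact F.shape_cell ▸ F.polygon.corner_mem_shape i
  | side F i => exact F.shape_cell ▸ F.polygon.sideMap_mem_shape _ (Cell.mem_shape_edge.1 hz).1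
  | face F => exact hz

/-- The embedding of the model of the smaller cell of an incidence into that of the larger one. -/
noncomputable def map (ρ : K.Incidence) (x : ρ.cell.shape) : ρ.host.shape :=
  ⟨ρ.embed x, ρ.embed_mem_shape x.2⟩

theorem embed_lineMap (ρ : K.Incidence) (x y : ℂ) (t : ℝ) :
    ρ.embed (lineMap x y t) = lineMap (ρ.embed x) (ρ.embed y) t := by
  cases ρ with
  | side F i =>
    have hre : (lineMap x y t).re = lineMap x.re y.re t :=
      apply_lineMap Complex.reLm.toAffineMap x y t
    simp only [embed, hre, apply_lineMap]
  | _ => simp [embed]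

theorem side_map_endpoint (F : K.Face) (i : Fin F.card) :
    (side F i).map ((endpoint (F.side i)).map (Cell.origin _)) =
      (corner F i).map (Cell.origin _) := by
  refine Subtype.ext ?_
  rcases hb : F.side i with ⟨e, _ | _⟩ <;>
    simp [map, embed, hb, ModelPolygon.sideMap, ModelPolygon.sideStart]

theorem side_map_endpoint_not (F : K.Face) (i : Fin F.card) :
    (side F i).map ((endpoint ((F.side i).1, !(F.side i).2)).map (Cell.origin _)) =
      (corner F (i + 1)).map (Cell.origin _) := by
  refine Subtype.ext ?_
  rcases hb : F.side i with ⟨e, _ | _⟩ <;>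
    simp [map, embed, hb, ModelPolygon.sideMap, ModelPolygon.sideStart]

theorem corner_zero_map_origin (F : K.Face) :
    (corner F 0).map (Cell.origin _) = F.cell.origin :=
  Subtype.ext (by cases F <;> rfl)

theorem IsFacet.charMap_map {ρ : K.Incidence} (hρ : ρ.IsFacet) (x : ρ.cell.shape) :
    charMap ρ.host (ρ.map x) = charMap ρ.cell x :=
  Quot.sound (glue_iff.2 ⟨ρ, hρ, rfl, rfl, rfl⟩)

theorem charMap_map (ρ : K.Incidence) (x : ρ.cell.shape) :
    charMap ρ.host (ρ.map x) = charMap ρ.cell x := by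
  cases ρ with
  | endpoint s => exact (IsFacet.endpoint s).charMap_map x
  | side F i => exact (IsFacet.side F i).charMap_map x
  | corner F i =>
    obtain rfl : x = Cell.origin _ := Subtype.ext x.2
    rw [← side_map_endpoint]
    exact ((IsFacet.side F i).charMap_map _).trans ((IsFacet.endpoint (F.side i)).charMap_map _)
  | _ => rfl

end Incidence

theorem charMap_origin (c : K.Cell) :
    charMap c c.origin = charMap (.vert c.base) (Cell.origin _) := by
  induction c using Cell.faceCases with
  | vert v => rfl
  | edge e => exact charMap_map (endpoint (e, true)) (Cell.origin _)
  | face F =>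
    rw [Cell.base_cell F]
    exact (congrArg (charMap F.cell) (corner_zero_map_origin F).symm).trans
      (charMap_map (corner F 0) (Cell.origin _))

/-- The image in the realization of a straight path in the model of a cell. -/
noncomputable def cellPath (c : K.Cell) (x y : c.shape) : Path (charMap c x) (charMap c y) :=
  (c.segment x y).map (continuous_charMap c)

theorem cellPath_map (ρ : K.Incidence) (x y : ρ.cell.shape) (t : unitInterval) :
    cellPath ρ.host (ρ.map x) (ρ.map y) t = cellPath ρ.cell x y t := by
  refine Eq.trans ?_ (ρ.charMap_map (ρ.cell.segment x y t))
  exact congrArg (charMap ρ.host) (Subtype.ext (ρ.embed_lineMap x y t).symm)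

/-- Extension to oriented edges of a function on edges. -/
def signed {π : Type*} [Group π] (ℓ : K.Edge → π) (s : K.Edge × Bool) : π :=
  bif s.2 then ℓ s.1 else (ℓ s.1)⁻¹

/-- A function on edges with values in a group is flat if its product around each face is
trivial. -/
def IsFlat {π : Type*} [Group π] (ℓ : K.Edge → π) : Prop :=
  ∀ F : K.Face, (List.ofFn fun i => signed ℓ (F.side i)).prod = 1

section Cyclic

variable {π : Type*} [Group π] {n : ℕ} [NeZero n]

theorem ofNat_add_one (k : ℕ) : Fin.ofNat n (k + 1) = Fin.ofNat n k + 1 :=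
  Fin.ext (by simp [Fin.val_add])

theorem prod_ofFn_inv_mul_add_one (w : Fin n → π) :
    (List.ofFn fun i => (w i)⁻¹ * w (i + 1)).prod = 1 := by
  have key (k : ℕ) (hk : k ≤ n) : ((List.ofFn fun i => (w i)⁻¹ * w (i + 1)).take k).prod =
      (w 0)⁻¹ * w (Fin.ofNat n k) := by
    induction k with
    | zero => simp
    | succ k ih =>
      have hk' : (⟨k, hk⟩ : Fin n) = Fin.ofNat n k := Fin.ext (Nat.mod_eq_of_lt hk).symm
      rw [List.prod_take_succ _ _ (by simpa using hk), ih (Nat.le_of_succ_le hk), List.getElem_ofFn,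
        hk', ofNat_add_one, mul_assoc, mul_inv_cancel_left]
  simpa [List.take_of_length_le] using key n le_rfl

theorem eq_of_add_one_eq_mul {g h s : Fin n → π} (h0 : g 0 = h 0)
    (hg : ∀ i, g (i + 1) = g i * s i) (hh : ∀ i, h (i + 1) = h i * s i) : g = h := by
  have key (k : ℕ) : g (Fin.ofNat n k) = h (Fin.ofNat n k) := by
    induction k with
    | zero => exact h0
    | succ k ih => rw [ofNat_add_one, hg, hh, ih]
  funext i
  simpa using key i

end Cyclic

section Character

variable {π : Type*} [Group π] (χ : PathCharacter K.Realization π)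

theorem char_cellPath_mul (c : K.Cell) (x y z : c.shape) :
    χ.toFun (cellPath c x y) * χ.toFun (cellPath c y z) = χ.toFun (cellPath c x z) := by
  rw [← χ.map_trans, cellPath, cellPath, ← Path.map_trans]
  exact (χ.comap (continuous_charMap c)).eq_of_simplyConnected _ _

theorem char_cellPath_self (c : K.Cell) (x : c.shape) : χ.toFun (cellPath c x x) = 1 :=
  left_eq_mul.1 (char_cellPath_mul χ c x x x).symm

theorem char_cellPath_inv (c : K.Cell) (x y : c.shape) :
    (χ.toFun (cellPath c x y))⁻¹ = χ.toFun (cellPath c y x) := by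
  rw [inv_eq_iff_mul_eq_one, char_cellPath_mul, char_cellPath_self]

theorem char_cellPath_map (ρ : K.Incidence) (x y : ρ.cell.shape) :
    χ.toFun (cellPath ρ.host (ρ.map x) (ρ.map y)) = χ.toFun (cellPath ρ.cell x y) :=
  χ.congr (cellPath_map ρ x y)

/-- The value of a path character on an edge. -/
noncomputable def edgeChar (e : K.Edge) : π :=
  χ.toFun (cellPath (.edge e) ((endpoint (e, true)).map (Cell.origin _))
    ((endpoint (e, false)).map (Cell.origin _)))

theorem char_cellPath_endpoint (s : K.Edge × Bool) :
    χ.toFun (cellPath (.edge s.1) ((endpoint s).map (Cell.origin _))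
      ((endpoint (s.1, !s.2)).map (Cell.origin _))) = signed (edgeChar χ) s := by
  obtain ⟨e, _ | _⟩ := s
  · exact (char_cellPath_inv χ _ _ _).symm
  · rfl

theorem char_cellPath_corner (F : K.Face) (i : Fin F.card) :
    χ.toFun (cellPath F.cell ((corner F i).map (Cell.origin _))
      ((corner F (i + 1)).map (Cell.origin _))) = signed (edgeChar χ) (F.side i) := by
  rw [← side_map_endpoint, ← side_map_endpoint_not, ← char_cellPath_endpoint]
  exact char_cellPath_map χ (side F i) _ _

theorem isFlat_edgeChar : IsFlat (edgeChar χ) := by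
  intro F
  let w (i : Fin F.card) :=
    χ.toFun (cellPath F.cell F.cell.origin ((corner F i).map (Cell.origin _)))
  have hw (i : Fin F.card) : signed (edgeChar χ) (F.side i) = (w i)⁻¹ * w (i + 1) := by
    rw [eq_inv_mul_iff_mul_eq, ← char_cellPath_corner]
    exact char_cellPath_mul χ _ _ _ _
  simp only [hw, prod_ofFn_inv_mul_add_one]

end Character

section Extend

variable {π : Type*} [Group π] {χ : PathCharacter K.Realization π} {v : K.Vert → π}

variable (χ v) in
/-- Extension of a function on vertices along straight paths in cells. -/
noncomputable def extend (a : K.PreRealization) : π :=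
  v a.1.base * χ.toFun (cellPath a.1 a.1.origin a.2)

theorem extend_mul_cellPath (c : K.Cell) (x y : c.shape) :
    extend χ v ⟨c, y⟩ = extend χ v ⟨c, x⟩ * χ.toFun (cellPath c x y) := by
  simp only [extend]
  rw [mul_assoc, char_cellPath_mul]

theorem extend_origin (c : K.Cell) : extend χ v ⟨c, c.origin⟩ = v c.base :=
  (congrArg (_ * ·) (char_cellPath_self χ c _)).trans (mul_one _)

variable (hv : ∀ e, v (K.tgt e) = v (K.src e) * edgeChar χ e)
include hv

theorem start_side_add_one (F : K.Face) (i : Fin F.card) :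
    v (K.start (F.side (i + 1))) = v (K.start (F.side i)) * signed (edgeChar χ) (F.side i) := by
  rw [show i + 1 = ModelPolygon.sideStart i false from rfl, F.start_side_sideStart]
  rcases F.side i with ⟨e, _ | _⟩ <;> simp [start, signed, hv]

theorem extend_corner (F : K.Face) (i : Fin F.card) :
    extend χ v ⟨F.cell, (corner F i).map (Cell.origin _)⟩ = v (K.start (F.side i)) := by
  refine congrFun (eq_of_add_one_eq_mul
    (g := fun i => extend χ v ⟨F.cell, (corner F i).map (Cell.origin _)⟩)
    (h := fun i => v (K.start (F.side i))) ?_ (fun i => ?_) (start_side_add_one hv F)) i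
  · refine Eq.trans ?_ ((extend_origin (χ := χ) F.cell).trans (congrArg v (Cell.base_cell F)))
    exact congrArg (fun x => extend χ v ⟨F.cell, x⟩) (corner_zero_map_origin F)
  · rw [← char_cellPath_corner]
    exact extend_mul_cellPath _ _ _

theorem extend_map_origin {ρ : K.Incidence} (hρ : ρ.IsFacet) :
    extend χ v ⟨ρ.host, ρ.map ρ.cell.origin⟩ = v ρ.cell.base := by
  rcases hρ with ⟨e, _ | _⟩ | ⟨F, i⟩
  · exact (hv e).symm
  · exact extend_origin (.edge e)
  · have h : (side F i).map (Cell.origin _) =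
        (corner F (ModelPolygon.sideStart i (F.side i).2)).map (Cell.origin _) := by
      refine Subtype.ext ?_
      simp [map, embed, Cell.origin, ModelPolygon.sideMap]
    refine (congrArg (fun x => extend χ v ⟨F.cell, x⟩) h).trans ((extend_corner hv F _).trans ?_)
    rw [F.start_side_sideStart]
    simp [start, cell, Cell.base]

theorem extend_glue {a b : K.PreRealization} (h : K.Glue a b) : extend χ v a = extend χ v b := by
  obtain ⟨c, x⟩ := a
  obtain ⟨d, y⟩ := b
  obtain ⟨ρ, hρ, rfl, rfl, hx⟩ := glue_iff.1 h
  obtain rfl : x = ρ.map y := Subtype.ext hx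
  rw [extend_mul_cellPath ρ.host (ρ.map ρ.cell.origin), extend_map_origin hv hρ, char_cellPath_map]
  rfl

end Extend

open Classical in
/-- The point of the model of a cell to which a point of the open star of `c` is contracted; points
outside of the open star are fixed. -/
noncomputable def starTarget (c : K.Cell) (a : K.PreRealization) : a.1.shape :=
  if h : a ∈ preStar c then
    ⟨h.choose.embed 0, Eq.subst (motive := (h.choose.embed 0 ∈ Cell.shape ·)) h.choose_spec.1
      (h.choose.embed_mem_shape (Cell.zero_mem_shape _))⟩
  else a.2

theorem coe_starTarget {ρ : K.Incidence} {a : K.PreRealization} (hhost : ρ.host = a.1)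
    {c : K.Cell} (hcell : ρ.cell = c) (ha : (a.2 : ℂ) ∈ ρ.region) :
    (starTarget c a : ℂ) = ρ.embed 0 := by
  have h : a ∈ preStar c := ⟨ρ, hhost, hcell, ha⟩
  obtain ⟨hhost', hcell', ha'⟩ := h.choose_spec
  have hmem : (a.2 : ℂ) ∈ ρ.host.shape := by rw [hhost]; exact a.2.2
  rw [starTarget, dif_pos h,
    eq_of_mem_region (hhost.trans hhost'.symm) (by rw [hcell, hcell']) hmem ha ha']

/-- The contraction of the open star of `c`. -/
noncomputable def starContraction (c : K.Cell) (a : K.PreRealization) :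
    C(unitInterval, K.Realization) :=
  (cellPath a.1 a.2 (starTarget c a)).toContinuousMap

theorem starContraction_glue (c : K.Cell) {a b : K.PreRealization} (hab : K.Glue a b) :
    starContraction c a = starContraction c b := by
  ext t
  by_cases h : a ∈ preStar c
  · obtain ⟨c', x⟩ := a
    obtain ⟨d, y⟩ := b
    obtain ⟨ρ₀, hρ₀, rfl, rfl, hx⟩ := glue_iff.1 hab
    obtain rfl : x = ρ₀.map y := Subtype.ext hx
    obtain ⟨ρ', hhost', rfl, hx'⟩ := h
    obtain ⟨ρ, hhost, hcell, hy, hembed⟩ := exists_factor hρ₀ hhost' y.2 hx'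
    have htarget : starTarget ρ'.cell ⟨ρ₀.host, ρ₀.map y⟩ =
        ρ₀.map (starTarget ρ'.cell ⟨ρ₀.cell, y⟩) := by
      refine Subtype.ext ?_
      rw [coe_starTarget hhost' rfl hx', hembed,
        ← coe_starTarget (a := ⟨ρ₀.cell, y⟩) hhost hcell hy]
      rfl
    exact (congrArg (fun w => cellPath ρ₀.host (ρ₀.map y) w t) htarget).trans
      (cellPath_map ρ₀ y _ t)
  · have h' := mt (mem_preStar_iff_of_glue hab c).2 h
    have hconst (a : K.PreRealization) : cellPath a.1 a.2 a.2 t = Quot.mk _ a :=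
      congrArg (charMap a.1) (Subtype.ext (lineMap_same_apply _ _))
    change cellPath a.1 a.2 (starTarget c a) t = cellPath b.1 b.2 (starTarget c b) t
    rw [starTarget, dif_neg h, starTarget, dif_neg h', hconst, hconst, Quot.sound hab]

theorem continuousOn_starContraction (c : K.Cell) :
    ContinuousOn (starContraction c) (preStar c) := by
  rintro ⟨d, x⟩ ⟨ρ, rfl, rfl, hx⟩
  refine ContinuousAt.continuousWithinAt ?_
  rw [← (Topology.IsOpenEmbedding.sigmaMk (σ := fun c : K.Cell => c.shape)).continuousAt_iff]
  have hc : Continuous fun y : ρ.host.shape =>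
      (cellPath ρ.host y (ρ.map ρ.cell.origin)).toContinuousMap := by
    refine ContinuousMap.continuous_of_continuous_uncurry _ ?_
    refine (continuous_charMap ρ.host).comp (Continuous.subtype_mk ?_ _)
    simp only [lineMap_apply_module]
    fun_prop
  refine hc.continuousAt.congr ?_
  filter_upwards [(ρ.isOpen_region.preimage continuous_subtype_val).mem_nhds hx] with y hy
  have htarget : starTarget ρ.cell ⟨ρ.host, y⟩ = ρ.map ρ.cell.origin :=
    Subtype.ext (coe_starTarget rfl rfl hy)
  exact congrArg (fun z => (cellPath ρ.host y z).toContinuousMap) htarget.symm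

/-- The contraction of the open star of `c`, after gluing. -/
noncomputable def contraction (c : K.Cell) : K.Realization → C(unitInterval, K.Realization) :=
  Quot.lift (starContraction c) fun _ _ h => starContraction_glue c h

theorem contraction_zero (c : K.Cell) (x : K.Realization) : contraction c x 0 = x := by
  induction x using Quot.ind with | mk a
  exact (cellPath a.1 a.2 (starTarget c a)).source

theorem contraction_one {c : K.Cell} {x : K.Realization} (hx : x ∈ openStar c) :
    contraction c x 1 = charMap c c.origin := by
  induction x using Quot.ind with | mk a
  obtain ⟨⟨d, x⟩, ρ, rfl, rfl, hρ⟩ := a, hx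
  refine (cellPath ρ.host x _).target.trans ?_
  rw [← charMap_map]
  exact congrArg (charMap ρ.host) (Subtype.ext (coe_starTarget rfl rfl hρ))

theorem continuousOn_contraction (c : K.Cell) : ContinuousOn (contraction c) (openStar c) := by
  rw [continuousOn_open_iff (isOpen_openStar c)]
  intro W hW
  exact isQuotientMap_quot_mk.isOpen_preimage.1
    ((continuousOn_open_iff (isOpen_preStar c)).1 (continuousOn_starContraction c) W hW)

theorem exists_isPrimitive {π : Type*} [Group π] {χ : PathCharacter K.Realization π}
    {v : K.Vert → π} (hv : ∀ e, v (K.tgt e) = v (K.src e) * edgeChar χ e) :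
    ∃ u, χ.IsPrimitive u := by
  let u : K.Realization → π := Quot.lift (extend χ v) fun _ _ h => extend_glue hv h
  refine ⟨u, χ.isPrimitive_of_local fun x => ?_⟩
  obtain ⟨c, hc⟩ := exists_mem_openStar x
  refine ⟨openStar c, (isOpen_openStar c).mem_nhds hc, fun y z γ hγ => ?_⟩
  refine χ.eq_mul_of_contraction (continuousOn_contraction c) (contraction_zero c)
    (fun _ => contraction_one) (fun x hx γ hγ => ?_) γ hγ
  induction x using Quot.ind with | mk a
  have hend : charMap a.1 (starTarget c a) = charMap c c.origin :=
    (cellPath a.1 a.2 (starTarget c a)).target.symm.trans (contraction_one hx)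
  have hchar : χ.toFun γ = χ.toFun (cellPath a.1 a.2 (starTarget c a)) := χ.congr hγ
  exact (congrArg u hend).symm.trans
    ((extend_mul_cellPath a.1 a.2 _).trans (congrArg (_ * ·) hchar.symm))

theorem joined_charMap_base (c : K.Cell) (x : c.shape) :
    Joined (charMap c x) (charMap (.vert c.base) (Cell.origin _)) :=
  charMap_origin c ▸ ⟨cellPath c x c.origin⟩

theorem pathConnectedSpace_realization [Nonempty K.Vert]
    (h : ∀ P : K.Vert → Prop, (∀ e, P (K.src e) ↔ P (K.tgt e)) → (∃ v, P v) → ∀ v, P v) :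
    PathConnectedSpace K.Realization := by
  let point (v : K.Vert) : K.Realization := charMap (.vert v) (Cell.origin _)
  obtain ⟨v₀⟩ := ‹Nonempty K.Vert›
  have hedge (e : K.Edge) : Joined (point (K.src e)) (point (K.tgt e)) := by
    have htgt := joined_charMap_base (.edge e) ((endpoint (e, false)).map (Cell.origin _))
    exact (charMap_map (endpoint (e, false)) (Cell.origin _) ▸ htgt).symm
  have hvert : ∀ v, Joined (point v) (point v₀) :=
    h _ (fun e => ⟨(hedge e).symm.trans, (hedge e).trans⟩) ⟨v₀, .refl _⟩
  have hjoin (x : K.Realization) : Joined x (point v₀) := by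
    obtain ⟨a, rfl⟩ := Quot.exists_rep x
    exact (joined_charMap_base a.1 a.2).trans (hvert _)
  exact ⟨⟨point v₀⟩, fun x y => (hjoin x).trans (hjoin y).symm⟩

theorem simplyConnectedSpace_realization [PathConnectedSpace K.Realization]
    (h : ∀ (π : Type) [Group π] (ℓ : K.Edge → π), IsFlat ℓ →
      ∃ v : K.Vert → π, ∀ e, v (K.tgt e) = v (K.src e) * ℓ e) :
    SimplyConnectedSpace K.Realization :=
  simplyConnectedSpace_of_isPrimitive fun _ χ =>
    exists_isPrimitive (h _ (edgeChar χ) (isFlat_edgeChar χ)).choose_spec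

end LozengeComplex

/-! ### Simple connectivity of the Brady complex -/

namespace Brady

open LozengeComplex

section Representation

variable {H : Type*} [Group H] {a : Fin 3 → H} (hcomm : a 0 * a 2 = a 2 * a 0)
  (h₁ : a 0 * a 1 * a 2 * a 0 = a 1 * (a 0 * a 1 * a 2))
  (h₂ : a 0 * a 1 * a 2 * a 1 = a 2 * (a 0 * a 1 * a 2))
  (h₄ : (a 0 * a 1 * a 2) ^ 4 = 1)

/-- The homomorphism from `G` determined by the images of the standard generators. In the presence
of the commutation relation, the braid relations say that conjugation by the product of the
generators shifts them. -/
def representation : G →* H :=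
  PresentedGroup.toGroup (f := a) <| by
    rintro r (rfl | rfl | rfl | rfl)
    · simpa only [map_mul, map_inv, FreeGroup.lift_apply_of, mul_inv_eq_one] using hcomm
    · simp only [map_mul, map_inv, FreeGroup.lift_apply_of, mul_inv_eq_one]
      apply mul_right_cancel (b := a 2)
      rw [mul_assoc _ (a 0), hcomm, ← mul_assoc, h₁]
      simp only [mul_assoc]
    · simp only [map_mul, map_inv, FreeGroup.lift_apply_of, mul_inv_eq_one]
      apply mul_left_cancel (a := a 0)
      rw [← mul_assoc, ← mul_assoc, h₂, ← mul_assoc, ← mul_assoc, ← hcomm]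
      simp only [mul_assoc]
    · simpa only [map_mul, map_pow, FreeGroup.lift_apply_of] using h₄

theorem representation_of (i : Fin 3) :
    representation hcomm h₁ h₂ h₄ (PresentedGroup.of i) = a i :=
  PresentedGroup.toGroup.of _

theorem representation_delta : representation hcomm h₁ h₂ h₄ δ = a 0 * a 1 * a 2 := by
  simp only [δ, σ₁, σ₂, σ₃, map_mul, representation_of]

end Representation

theorem induction_on_mul {P : G → Prop} (h_one : P 1) (h_σ₁ : ∀ g, P g ↔ P (g * σ₁))
    (h_delta : ∀ g, P g ↔ P (g * δ)) (g : G) : P g := by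
  have h_σ₂ (g : G) : P g ↔ P (g * σ₂) := by
    rw [h_delta g, h_σ₁, h_delta (g * σ₂), mul_assoc, delta_mul_σ₁, mul_assoc]
  have h_σ₃ (g : G) : P g ↔ P (g * σ₃) := by
    rw [h_delta g, h_σ₂, h_delta (g * σ₃), mul_assoc, delta_mul_σ₂, mul_assoc]
  have h_of (i : Fin 3) (g : G) : P g ↔ P (g * PresentedGroup.of i) := by
    fin_cases i
    exacts [h_σ₁ g, h_σ₂ g, h_σ₃ g]
  have h_mul (k : G) : ∀ g, P g ↔ P (g * k) := by
    induction (PresentedGroup.closure_range_of relators ▸ Subgroup.mem_top k :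
      k ∈ Subgroup.closure (Set.range PresentedGroup.of)) using Subgroup.closure_induction with
    | mem x hx =>
      obtain ⟨i, rfl⟩ := hx
      exact h_of i
    | one => simp
    | mul x y _ _ hx hy => intro g; rw [hx, hy, mul_assoc]
    | inv x _ hx => intro g; rw [hx (g * x⁻¹), inv_mul_cancel_right]
  simpa using (h_mul g 1).1 h_one

theorem apply_out_mk {H α : Type*} [Group H] {d : H} {u : H → α} (hu : ∀ g, u (g * d) = u g)
    (g : H) : u (QuotientGroup.mk g : H ⧸ Subgroup.zpowers d).out = u g := by
  obtain ⟨⟨_, n, rfl⟩, h⟩ := QuotientGroup.mk_out_eq_mul (Subgroup.zpowers d) g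
  have hzpow (n : ℤ) : u (g * d ^ n) = u g := by
    induction n with
    | zero => rw [zpow_zero, mul_one]
    | succ n ih => rw [zpow_add_one, ← mul_assoc, hu, ih]
    | pred n ih =>
      rw [← ih, ← hu (g * d ^ (-(n : ℤ) - 1)), mul_assoc, ← zpow_add_one, sub_add_cancel]
  exact h ▸ hzpow n

theorem delta_sq_mul_delta_sq : δ ^ 2 * δ ^ 2 = 1 := by rw [← pow_add, delta_pow_four]

theorem delta_sq_mul_σ₃ : δ ^ 2 * σ₃ = σ₁ * δ ^ 2 := by
  rw [← mul_left_inj (δ ^ 2), mul_assoc, ← delta_sq_mul_σ₁, ← mul_assoc, mul_assoc σ₁,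
    delta_sq_mul_delta_sq, one_mul, mul_one]

section Cocycle

variable {π : Type*} [Group π]

variable (π) in
/-- The action of `G` on the functions on `G` by translations on the right. -/
def translation : G →* MulAut (G → π) where
  toFun g :=
    { toFun := fun f x => f (x * g)
      invFun := fun f x => f (x * g⁻¹)
      left_inv := fun f => by simp
      right_inv := fun f => by simp
      map_mul' := fun _ _ => rfl }
  map_one' := by ext; simp
  map_mul' g h := by ext; simp [mul_assoc]

@[simp]
theorem translation_apply (g : G) (f : G → π) (x : G) : translation π g f x = f (x * g) := rfl

variable {ℓ : G → π} (htri : ∀ g, ℓ g * ℓ (g * (σ₁ * δ)) * ℓ (g * (σ₁ * δ) * (σ₁ * δ)) = 1)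
  (hloz : ∀ g, ℓ g * ℓ (g * σ₁ * δ ^ 2) = ℓ (g * δ ^ 2) * ℓ (g * σ₃))

variable (ℓ) in
/-- Lifts of the standard generators to the semidirect product of the functions on `G` with `G`. -/
def lifts : Fin 3 → (G → π) ⋊[translation π] G :=
  ![⟨ℓ, σ₁⟩, ⟨fun g => ℓ (g * δ), σ₂⟩, ⟨fun g => ℓ (g * δ ^ 2), σ₃⟩]

include htri in
theorem lifts_prod : lifts ℓ 0 * lifts ℓ 1 * lifts ℓ 2 = SemidirectProduct.inr δ := by
  refine SemidirectProduct.ext (funext fun g => ?_) rfl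
  change ℓ g * ℓ (g * σ₁ * δ) * ℓ (g * (σ₁ * σ₂) * δ ^ 2) = 1
  have h : σ₁ * σ₂ * δ ^ 2 = σ₁ * δ * (σ₁ * δ) := by
    rw [pow_two, mul_assoc, ← mul_assoc σ₂, ← delta_mul_σ₁]
    simp only [mul_assoc]
  rw [mul_assoc g, mul_assoc g, h, ← mul_assoc g (σ₁ * δ), htri]

/-- A flat labelling of the edges of the Brady complex makes the lifts of the generators satisfy the
defining relations of `G`. -/
def liftHom : G →* (G → π) ⋊[translation π] G :=
  representation (a := lifts ℓ)
    (SemidirectProduct.ext (funext hloz) comm13)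
    (by
      rw [lifts_prod htri]
      refine SemidirectProduct.ext (funext fun g => ?_) delta_mul_σ₁
      simp [lifts])
    (by
      rw [lifts_prod htri]
      refine SemidirectProduct.ext (funext fun g => ?_) delta_mul_σ₂
      simp [lifts, pow_two, mul_assoc])
    (by rw [lifts_prod htri, ← map_pow, delta_pow_four, map_one])

theorem right_liftHom (g : G) : (liftHom htri hloz g).right = g := by
  suffices SemidirectProduct.rightHom.comp (liftHom htri hloz) = MonoidHom.id G from
    DFunLike.congr_fun this g
  refine PresentedGroup.ext fun i => ?_
  simp only [liftHom, MonoidHom.comp_apply, representation_of]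
  fin_cases i <;> rfl

-- The first component of a section of the semidirect product is a crossed homomorphism.
include htri hloz in
theorem exists_eq_mul_of_flat :
    ∃ u : G → π, (∀ g, u (g * σ₁) = u g * ℓ g) ∧ ∀ g, u (g * δ) = u g := by
  refine ⟨fun g => (liftHom htri hloz g).left 1, fun g => ?_, fun g => ?_⟩
  · have hσ₁ : liftHom htri hloz σ₁ = ⟨ℓ, σ₁⟩ := representation_of ..
    simp [hσ₁, right_liftHom]
  · have hδ : liftHom htri hloz δ = SemidirectProduct.inr δ :=
      (representation_delta ..).trans (lifts_prod htri)
    simp [hδ]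

end Cocycle

theorem tri_flat_of_isFlat {π : Type*} [Group π] {ℓ : bradyComplex.Edge → π} (h : IsFlat ℓ)
    (g : G) : ℓ g * ℓ (g * (σ₁ * δ)) * ℓ (g * (σ₁ * δ) * (σ₁ * δ)) = 1 := by
  have hout (t : G ⧸ Subgroup.zpowers (σ₁ * δ)) :
      ℓ t.out * ℓ (t.out * (σ₁ * δ)) * ℓ (t.out * (σ₁ * δ) * (σ₁ * δ)) = 1 := by
    have ht : ℓ t.out * (ℓ (t.out * (σ₁ * δ)) * (ℓ (t.out * (σ₁ * δ) * (σ₁ * δ)) * 1)) = 1 :=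
      h (.tri t)
    rwa [mul_one, ← mul_assoc] at ht
  refine (iff_of_eq (apply_out_mk (d := σ₁ * δ) (u := fun g : G =>
    ℓ g * ℓ (g * (σ₁ * δ)) * ℓ (g * (σ₁ * δ) * (σ₁ * δ)) = 1) (fun g => ?_) g)).1 (hout _)
  have hcube : g * (σ₁ * δ) * (σ₁ * δ) * (σ₁ * δ) = g := by
    rw [mul_assoc g, mul_assoc g, σ₁_mul_delta_pow_three, mul_one]
  rw [hcube, mul_eq_one_comm, ← mul_assoc]

theorem loz_flat_of_isFlat {π : Type*} [Group π] {ℓ : bradyComplex.Edge → π} (h : IsFlat ℓ)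
    (g : G) : ℓ g * ℓ (g * σ₁ * δ ^ 2) = ℓ (g * δ ^ 2) * ℓ (g * σ₃) := by
  have hout (l : G ⧸ Subgroup.zpowers (δ ^ 2)) :
      ℓ l.out * ℓ (l.out * σ₁ * δ ^ 2) = ℓ (l.out * δ ^ 2) * ℓ (l.out * σ₃) := by
    have hl : ℓ (l.out * σ₁ * δ ^ 2) *
        ((ℓ (l.out * σ₃))⁻¹ * ((ℓ (l.out * δ ^ 2))⁻¹ * (ℓ l.out * 1))) = 1 := h (.loz l)
    rwa [mul_eq_one_comm, mul_assoc, mul_assoc, mul_one, inv_mul_eq_one, eq_inv_mul_iff_mul_eq,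
      eq_comm] at hl
  refine (iff_of_eq (apply_out_mk (d := δ ^ 2) (u := fun g : G =>
    ℓ g * ℓ (g * σ₁ * δ ^ 2) = ℓ (g * δ ^ 2) * ℓ (g * σ₃)) (fun g => ?_) g)).1 (hout _)
  rw [mul_assoc g (δ ^ 2) (δ ^ 2), mul_assoc g (δ ^ 2) σ₁, mul_assoc g (δ ^ 2) σ₃,
    delta_sq_mul_σ₁, delta_sq_mul_σ₃, ← mul_assoc g σ₁, ← mul_assoc g σ₃,
    mul_assoc _ (δ ^ 2) (δ ^ 2), delta_sq_mul_delta_sq, mul_one, mul_one]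
  exact propext eq_comm

instance pathConnectedSpace_bradyComplex : PathConnectedSpace bradyComplex.Realization := by
  have : Nonempty bradyComplex.Vert := ⟨(QuotientGroup.mk 1 : Vert)⟩
  refine pathConnectedSpace_realization ?_
  rintro P hP ⟨v, hv⟩ w
  obtain ⟨g, rfl⟩ := QuotientGroup.mk_surjective v
  obtain ⟨h, rfl⟩ := QuotientGroup.mk_surjective w
  have hmul : ∀ k, P (QuotientGroup.mk (g * k) : Vert) := by
    refine induction_on_mul ?_ (fun k => ?_) (fun k => ?_)
    · rwa [mul_one]
    · rw [← mul_assoc]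
      exact hP (g * k)
    · rw [← mul_assoc, mk_mul_delta]
  exact mul_inv_cancel_left g h ▸ hmul (g⁻¹ * h)

theorem simplyConnectedSpace_bradyComplex : SimplyConnectedSpace bradyComplex.Realization := by
  refine simplyConnectedSpace_realization fun π _ ℓ hℓ => ?_
  obtain ⟨u, hσ₁, hδ⟩ := exists_eq_mul_of_flat (tri_flat_of_isFlat hℓ) (loz_flat_of_isFlat hℓ)
  refine ⟨fun v : Vert => u v.out, fun g : G => ?_⟩
  exact (apply_out_mk hδ (g * σ₁)).trans
    ((hσ₁ g).trans (congrArg (· * ℓ g) (apply_out_mk hδ g).symm))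

end Brady

/-! ### The covering of `V` by the Brady complex -/

namespace PolygonIso

open ModelPolygon

variable {n : ℕ} [NeZero n] {M : ModelPolygon n}

/-- The symmetry of a polygon with the sides mapped by `i ↦ r + i` or, if it is a reflection, by
`i ↦ r - i`. -/
def ofDihedral (r : Fin n) (reflected : Bool) (T : ℂ ≃ᵃⁱ[ℝ] ℂ)
    (hT : ∀ i, T (M.corner i) = M.corner (bif reflected then r - i + 1 else r + i)) :
    PolygonIso M M where
  toIso := T
  side := bif reflected then Equiv.subLeft r else Equiv.addLeft r
  reversed := reflected
  map_sideStart i b := by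
    rw [hT]
    refine congrArg M.corner ?_
    cases reflected <;> cases b <;> simp [sideStart, add_assoc, sub_add_eq_sub_sub]

theorem side_ofDihedral (r : Fin n) (reflected : Bool) (T : ℂ ≃ᵃⁱ[ℝ] ℂ)
    (hT : ∀ i, T (M.corner i) = M.corner (bif reflected then r - i + 1 else r + i)) (i : Fin n) :
    (ofDihedral r reflected T hT).side i = bif reflected then r - i else r + i := by
  cases reflected <;> rfl

end PolygonIso

namespace LozengeComplex

open ComplexConjugate

/-- The isometry of the plane which maps `0` to `p` and `1` to `q`, and reverses the orientation
if `reflected` holds. -/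
noncomputable def planeIso (p q : ℂ) (h : ‖q - p‖ = 1) (reflected : Bool) : ℂ ≃ᵃⁱ[ℝ] ℂ :=
  ((bif reflected then Complex.conjLIE else .refl ℝ ℂ).trans
    (rotation ⟨q - p, mem_sphere_zero_iff_norm.2 h⟩)).toAffineIsometryEquiv.trans
    (.vaddConst ℝ p)

theorem planeIso_apply {p q : ℂ} (h : ‖q - p‖ = 1) (reflected : Bool) (z : ℂ) :
    planeIso p q h reflected z = (q - p) * (bif reflected then conj z else z) + p := by
  cases reflected <;> rfl

theorem omega_mul_omega : omega * omega = omega - 1 := by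
  have h3 : (√3 : ℝ) * √3 = 3 := Real.mul_self_sqrt (by norm_num)
  apply Complex.ext <;> simp [omega] <;> linarith

theorem conj_omega : conj omega = 1 - omega := by
  apply Complex.ext <;> simp [omega]
  norm_num

theorem norm_omega : ‖omega‖ = 1 := by
  have h3 : (√3 : ℝ) * √3 = 3 := Real.mul_self_sqrt (by norm_num)
  rw [Complex.norm_def, Real.sqrt_eq_one, Complex.normSq_apply]
  simp only [omega]
  linarith

theorem norm_one_sub_omega : ‖1 - omega‖ = 1 := by
  rw [← conj_omega, Complex.norm_conj, norm_omega]

theorem norm_omega_sub_one : ‖omega - 1‖ = 1 := by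
  rw [norm_sub_rev, norm_one_sub_omega]

/-- The symmetry of the model triangle with sides mapped by `i ↦ r + i` or, if it is a reflection,
by `i ↦ r - i`. -/
noncomputable def triangleSymmetry (r : Fin 3) (reflected : Bool) :
    PolygonIso trianglePolygon trianglePolygon :=
  .ofDihedral r reflected
    (planeIso (triCorner (bif reflected then r + 1 else r))
      (triCorner (bif reflected then r else r + 1))
      (by
        fin_cases r <;> cases reflected <;>
          simp [triCorner, norm_omega, norm_one_sub_omega, norm_omega_sub_one])
      reflected)
    (fun i => by
      rw [planeIso_apply]
      fin_cases r <;> cases reflected <;> fin_cases i <;>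
        simp [trianglePolygon, triCorner, conj_omega, mul_sub, sub_mul, omega_mul_omega,
          show (-2 + 1 : Fin 3) = 2 from rfl])

theorem side_triangleSymmetry (r : Fin 3) (reflected : Bool) (i : Fin 3) :
    (triangleSymmetry r reflected).side i = bif reflected then r - i else r + i :=
  PolygonIso.side_ofDihedral ..

/-- The symmetries of the model lozenge: the identity and the half turn, mapping the sides by
`i ↦ i` and `i ↦ 2 + i`, and the reflections, mapping them by `i ↦ 3 - i` and `i ↦ 1 - i`. -/
noncomputable def lozengeSymmetry (turned reflected : Bool) :
    PolygonIso lozengePolygon lozengePolygon :=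
  .ofDihedral
    (bif reflected then (bif turned then 1 else 3) else (bif turned then 2 else 0)) reflected
    (planeIso (bif turned then 1 + omega else 0)
      (bif turned then (bif reflected then 1 else omega) else (bif reflected then omega else 1))
      (by cases turned <;> cases reflected <;> simp [norm_omega])
      reflected)
    (fun i => by
      rw [planeIso_apply]
      cases turned <;> cases reflected <;> fin_cases i <;>
        simp [lozengePolygon, lozCorner, conj_omega, mul_sub, mul_add, omega_mul_omega] <;> ring)

theorem side_lozengeSymmetry (turned reflected : Bool) (i : Fin 4) :
    (lozengeSymmetry turned reflected).side i =
      bif reflected then (bif turned then 1 else 3) - i else (bif turned then 2 else 0) + i := by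
  refine (PolygonIso.side_ofDihedral ..).trans ?_
  cases reflected <;> rfl

theorem Hom.isCovering_of_links {K L : LozengeComplex} {φ : Hom K L}
    (hvert : Function.Surjective φ.vert) (hedge : Function.Surjective φ.edge)
    (hface : Function.Surjective φ.face)
    (hstart : ∀ v s', L.start s' = φ.vert v → ∃! s, φ.mapSide s = s' ∧ K.start s = v)
    (hside : ∀ e F', (∃ k, (F'.side k).1 = φ.edge e) →
      ∃! F, φ.face F = F' ∧ ∃ i, (F.side i).1 = e)
    (hinj : ∀ F' : L.Face, Function.Injective fun k => (F'.side k).1) : φ.IsCovering where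
  cellMap_surjective c := by
    induction c using Cell.faceCases with
    | vert v => exact (hvert v).imp' .vert fun _ h => congrArg _ h
    | edge e => exact (hedge e).imp' .edge fun _ h => congrArg _ h
    | face F => exact (hface F).imp' Face.cell fun F h => (φ.cellMap_cell F).trans (congrArg _ h)
  existsUnique_facet := by
    rintro c _ (⟨s'⟩ | ⟨F', k⟩) hc
    · induction c using Cell.faceCases with
      | vert v =>
        obtain ⟨s, ⟨hs, hv⟩, hunique⟩ := hstart v s' (Cell.vert.inj hc)
        refine ⟨.endpoint s, ⟨congrArg _ hs, congrArg _ hv⟩, ?_⟩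
        rintro (_ | t | _ | _ | _ | _) ⟨ht, htv⟩ <;> cases ht
        rw [hunique t ⟨rfl, Cell.vert.inj htv⟩]
      | edge e => cases hc
      | face F => exact absurd (hc.trans (φ.cellMap_cell F)).symm (Face.cell_ne_vert _ _)
    · induction c using Cell.faceCases with
      | vert v => cases hc
      | edge e =>
        have hk : (F'.side k).1 = φ.edge e := Cell.edge.inj hc
        obtain ⟨F, ⟨rfl, i, rfl⟩, hunique⟩ := hside e F' ⟨k, hk⟩
        have hside_eq (j) : ((φ.face F).side ((φ.iso F).side j)).1 = φ.edge (F.side j).1 :=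
          congrArg Prod.fst (φ.side_face F j)
        obtain rfl : (φ.iso F).side i = k := hinj _ ((hside_eq i).trans hk.symm)
        refine ⟨.side F i, ⟨rfl, rfl⟩, ?_⟩
        rintro (_ | _ | _ | _ | ⟨F₁, j⟩ | _) ⟨hj, hje⟩ <;> try cases hj
        have he := Cell.edge.inj hje
        have hF : F₁ = F := hunique F₁ ⟨(Incidence.side.inj hj).1, j, he⟩
        subst hF
        rw [(φ.iso F₁).side.injective (eq_of_heq (Incidence.side.inj hj).2)]
      | face F => exact absurd (hc.trans (φ.cellMap_cell F)).symm (Face.cell_ne_edge _ _)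

end LozengeComplex

namespace HamiltonianSurface

instance : DecidableEq Letter := fun k l => by
  cases k <;> cases l <;> first | exact .isTrue rfl | exact .isFalse nofun

instance : DecidableEq Index := fun k l => by
  cases k <;> cases l <;> first | exact .isTrue rfl | exact .isFalse nofun

instance : Fintype Letter := ⟨{.x, .y, .z}, by rintro ⟨⟩ <;> decide⟩

instance : Fintype Index := ⟨{.a, .b, .c, .d}, by rintro ⟨⟩ <;> decide⟩

/-- The right action of `σ₁` and of `σ₃` on the edges of `V`. For `Γ` the group of covering
transformations, these edges are the cosets `Γ g` in the group `G` of edges of the Brady complex;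
the coset of `1` is `x_a`. -/
def actσ₁ : Edge → Edge
  | (.x, .a) => (.x, .b) | (.x, .b) => (.x, .a) | (.x, .c) => (.x, .d) | (.x, .d) => (.x, .c)
  | (.y, .a) => (.y, .c) | (.y, .c) => (.y, .a) | (.y, .b) => (.y, .d) | (.y, .d) => (.y, .b)
  | (.z, .a) => (.z, .c) | (.z, .c) => (.z, .d) | (.z, .d) => (.z, .b) | (.z, .b) => (.z, .a)

/-- The right action of `σ₂` on the edges of `V`. -/
def actσ₂ : Edge → Edge
  | (.x, .a) => (.y, .c) | (.x, .d) => (.y, .b) | (.x, .b) => (.z, .d) | (.x, .c) => (.z, .a)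
  | (.y, .a) => (.z, .b) | (.y, .d) => (.z, .c) | (.y, .b) => (.x, .a) | (.y, .c) => (.x, .d)
  | (.z, .a) => (.x, .c) | (.z, .d) => (.x, .b) | (.z, .b) => (.y, .a) | (.z, .c) => (.y, .d)

/-- The right action of `δ` on the edges of `V`. -/
def actδ (e : Edge) : Edge := actσ₁ (actσ₂ (actσ₁ e))

/-- The right action of `σ₁ δ`, which rotates the triangles, on the edges of `V`. -/
def rotateTri (e : Edge) : Edge := actδ (actσ₁ e)

/-- The permutation `actσ₁`. -/
def permσ₁ : Equiv.Perm Edge where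
  toFun := actσ₁
  invFun := actσ₁^[3]
  left_inv := by unfold Function.LeftInverse; decide
  right_inv := by unfold Function.RightInverse Function.LeftInverse; decide

/-- The permutation `actσ₂`. -/
def permσ₂ : Equiv.Perm Edge where
  toFun := actσ₂
  invFun := actσ₂^[3]
  left_inv := by unfold Function.LeftInverse; decide
  right_inv := by unfold Function.RightInverse Function.LeftInverse; decide

/-- Whether the orientation of an edge of `V` differs from that of the edges of the Brady complex
above it. -/
def flip : Edge → Bool
  | (_, .a) => false | (_, .b) => true | (_, .c) => true | (_, .d) => false

/-- The vertex of `V` below the initial vertices of the edges of the Brady complex above `e`. -/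
def origin (e : Edge) : Fin 3 := bif flip e then tgt e else src e

/-- The position of an edge in the boundary of its triangle. -/
def Letter.num : Letter → Fin 3
  | .x => 0 | .y => 1 | .z => 2

/-- The lozenge of `V` below the lozenges of the Brady complex with obtuse corner at the initial
vertex of an edge above `e`. -/
def lozOf : Edge → Letter ⊕ Letter
  | (l, .a) => .inr l | (l, .b) => .inl l | (l, .c) => .inl l | (l, .d) => .inr l

/-- Whether the Brady lozenge of an edge above `e` is turned, in the sense of `lozengeSymmetry`,
with respect to `lozOf e`. -/
def lozTurned : Edge → Bool
  | (_, .a) => false | (_, .d) => true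
  | (.y, .b) => false | (_, .b) => true | (.y, .c) => true | (_, .c) => false

/-- Whether the Brady lozenge of an edge above `e` is reflected with respect to `lozOf e`. -/
def lozReflected : Edge → Bool
  | (_, .a) => false | (_, .d) => true
  | (.y, .b) => true | (_, .b) => false | (.y, .c) => false | (_, .c) => true

/-- The images of the sides of the Brady lozenge of an edge above `e`. -/
def bradyLozSide (e : Edge) : Fin 4 → Edge × Bool :=
  ![(actδ (actδ (actσ₁ e)), true), (actσ₁ e, false), (actδ (actδ e), false), (e, true)]

theorem origin_actδ : ∀ e, origin (actδ e) = origin e := by decide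

theorem start_eq_origin : ∀ s : Edge × Bool, complexV.start s =
    origin (bif flip s.1 ^^ s.2 then s.1 else actσ₁ s.1) := by
  unfold LozengeComplex.start complexV LozengeComplex.attachLozenges surfaceS
  decide

theorem existsUnique_actδ_iterate : ∀ e e', origin e = origin e' →
    ∃! i : Fin 4, actδ^[i] e = e' := by
  unfold ExistsUnique
  decide

theorem exists_act_iterate : ∀ e, ∃ i j k : Fin 4,
    actδ^[i] (actσ₁^[j] (actδ^[k] (.x, .a))) = e := by
  decide

theorem rotateTri_snd : ∀ e, (rotateTri e).2 = e.2 := by decide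

theorem lozOf_actδ_actδ : ∀ e, lozOf (actδ (actδ e)) = lozOf e := by decide

theorem lozOf_actσ₁_ne : ∀ e, lozOf (actσ₁ e) ≠ lozOf e := by decide

theorem lozOf_surjective : Function.Surjective lozOf := by
  unfold Function.Surjective
  decide

theorem origin_surjective : Function.Surjective origin := by
  unfold Function.Surjective
  decide

theorem triSide_rotateTri : ∀ e (i : Fin 3),
    triSide e.2 (bif flip e then e.1.num - i else e.1.num + i) =
      (rotateTri^[i] e, flip (rotateTri^[i] e) ^^ (flip e ^^ true)) := by
  decide

theorem lozSide_lozOf : ∀ e (i : Fin 4), Sum.elim lozSide fillSide (lozOf e)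
    (bif lozReflected e then (bif lozTurned e then 1 else 3) - i
      else (bif lozTurned e then 2 else 0) + i) =
    ((bradyLozSide e i).1,
      flip (bradyLozSide e i).1 ^^ (lozReflected e ^^ (bradyLozSide e i).2)) := by
  decide

theorem exists_triSide_eq_iff : ∀ t e, (∃ i, (triSide t i).1 = e) ↔ t = e.2 := by decide

theorem exists_lozSide_eq_iff : ∀ l e, (∃ i, (Sum.elim lozSide fillSide l i).1 = actσ₁ e) ↔
    l = lozOf (actσ₁ e) ∨ l = lozOf e := by
  decide

theorem face_side_injective (F : complexV.Face) : Function.Injective fun i => (F.side i).1 := by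
  have htri : ∀ t i j, (triSide t i).1 = (triSide t j).1 → i = j := by decide
  have hloz : ∀ l i j, (Sum.elim lozSide fillSide l i).1 = (Sum.elim lozSide fillSide l j).1 →
      i = j := by
    decide
  cases F with
  | tri t => exact htri t
  | loz l => exact hloz l

end HamiltonianSurface

namespace Brady

open LozengeComplex HamiltonianSurface

theorem mk_eq_mk_iff_of_pow_eq_one {H : Type*} [Group H] {d : H} {n : ℕ} [NeZero n]
    (hd : d ^ n = 1) {g h : H} :
    (QuotientGroup.mk g : H ⧸ Subgroup.zpowers d) = QuotientGroup.mk h ↔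
      ∃ i : Fin n, g * d ^ (i : ℕ) = h := by
  have hn : (0 : ℤ) < n := by exact_mod_cast NeZero.pos n
  rw [QuotientGroup.eq, Subgroup.mem_zpowers_iff]
  constructor
  · rintro ⟨m, hm⟩
    lift m % n to ℕ using Int.emod_nonneg m hn.ne' with i hi
    have hin : i < n := by exact_mod_cast hi ▸ Int.emod_lt_of_pos m hn
    have hdm : d ^ m = d ^ i := by
      rw [zpow_eq_zpow_emod' m hd, ← hi, zpow_natCast]
    exact ⟨⟨i, hin⟩, by rw [← hdm, hm, mul_inv_cancel_left]⟩
  · rintro ⟨i, rfl⟩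
    exact ⟨i, by rw [zpow_natCast, inv_mul_cancel_left]⟩

/-- The right action of `G` on the edges of `V`. -/
def edgeAction : G →* (Equiv.Perm HamiltonianSurface.Edge)ᵐᵒᵖ :=
  representation (a := ![.op permσ₁, .op permσ₂, .op permσ₁])
    (MulOpposite.unop_injective <| Equiv.ext <| by decide)
    (MulOpposite.unop_injective <| Equiv.ext <| by decide)
    (MulOpposite.unop_injective <| Equiv.ext <| by decide)
    (MulOpposite.unop_injective <| Equiv.ext <| by decide)

/-- The edge of `V` below an edge of the Brady complex. -/
def edgeMap (g : G) : HamiltonianSurface.Edge := (edgeAction g).unop (.x, .a)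

theorem edgeMap_mul (g h : G) : edgeMap (g * h) = (edgeAction h).unop (edgeMap g) := by
  rw [edgeMap, map_mul]
  rfl

theorem edgeMap_mul_σ₁ (g : G) : edgeMap (g * σ₁) = actσ₁ (edgeMap g) := by
  rw [edgeMap_mul, edgeAction, σ₁, representation_of]
  rfl

theorem edgeMap_mul_σ₃ (g : G) : edgeMap (g * σ₃) = actσ₁ (edgeMap g) := by
  rw [edgeMap_mul, edgeAction, σ₃, representation_of]
  rfl

theorem edgeMap_mul_δ (g : G) : edgeMap (g * δ) = actδ (edgeMap g) := by
  rw [edgeMap_mul, edgeAction, representation_delta]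
  rfl

theorem edgeMap_mul_σ₁_mul_δ (g : G) : edgeMap (g * (σ₁ * δ)) = rotateTri (edgeMap g) := by
  rw [← mul_assoc, edgeMap_mul_δ, edgeMap_mul_σ₁, rotateTri]

theorem edgeMap_mul_δ_sq (g : G) : edgeMap (g * δ ^ 2) = actδ (actδ (edgeMap g)) := by
  rw [pow_two, ← mul_assoc, edgeMap_mul_δ, edgeMap_mul_δ]

theorem edgeMap_mul_pow {h : G} {f : HamiltonianSurface.Edge → HamiltonianSurface.Edge}
    (hf : ∀ g, edgeMap (g * h) = f (edgeMap g)) (g : G) (n : ℕ) :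
    edgeMap (g * h ^ n) = f^[n] (edgeMap g) := by
  induction n with
  | zero => rw [pow_zero, mul_one, Function.iterate_zero_apply]
  | succ n ih => rw [pow_succ, ← mul_assoc, hf, ih, Function.iterate_succ_apply']

theorem edgeMap_surjective : Function.Surjective edgeMap := by
  intro e
  obtain ⟨i, j, k, h⟩ := exists_act_iterate e
  refine ⟨1 * δ ^ (k : ℕ) * σ₁ ^ (j : ℕ) * δ ^ (i : ℕ), ?_⟩
  rw [edgeMap_mul_pow edgeMap_mul_δ, edgeMap_mul_pow edgeMap_mul_σ₁, edgeMap_mul_pow edgeMap_mul_δ,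
    edgeMap, map_one]
  exact h

/-- The vertex of `V` below a vertex of the Brady complex. -/
noncomputable def vertMap (v : Vert) : Fin 3 := origin (edgeMap v.out)

theorem vertMap_mk (g : G) : vertMap (QuotientGroup.mk g) = origin (edgeMap g) :=
  apply_out_mk (u := fun g => origin (edgeMap g))
    (fun g => (congrArg origin (edgeMap_mul_δ g)).trans (origin_actδ _)) g

theorem existsUnique_edge {v : Vert} {e : HamiltonianSurface.Edge} (he : origin e = vertMap v) :
    ∃! g : G, edgeMap g = e ∧ QuotientGroup.mk g = v := by
  obtain ⟨g, rfl⟩ := QuotientGroup.mk_surjective v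
  obtain ⟨i, hi, hunique⟩ :=
    existsUnique_actδ_iterate (edgeMap g) e ((vertMap_mk g).symm.trans he.symm)
  refine ⟨g * δ ^ (i : ℕ), ⟨(edgeMap_mul_pow edgeMap_mul_δ g i).trans hi, ?_⟩, ?_⟩
  · exact ((mk_eq_mk_iff_of_pow_eq_one delta_pow_four).2 ⟨i, rfl⟩).symm
  · rintro h ⟨hh, hgh⟩
    obtain ⟨j, rfl⟩ := (mk_eq_mk_iff_of_pow_eq_one delta_pow_four).1 hgh.symm
    rw [hunique j ((edgeMap_mul_pow edgeMap_mul_δ g j).symm.trans hh)]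

theorem triSide_eq (t : bradyComplex.Tri) (i : Fin 3) :
    bradyComplex.triSide t i = ((Quotient.out t * (σ₁ * δ) ^ (i : ℕ) : G), true) := by
  fin_cases i
  · exact congrArg (·, true) (mul_one _).symm
  · exact congrArg (fun k => (_ * k, true)) (pow_one _).symm
  · refine congrArg (·, true) ?_
    exact (mul_assoc (Quotient.out t : G) (σ₁ * δ) (σ₁ * δ)).trans (by rw [← pow_two])

theorem exists_triSide_eq_iff (t : bradyComplex.Tri) (g : G) :
    (∃ i, (bradyComplex.triSide t i).1 = g) ↔ t = QuotientGroup.mk g := by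
  have hd : (σ₁ * δ) ^ 3 = 1 := by
    rw [pow_succ, pow_two, σ₁_mul_delta_pow_three]
  simp only [triSide_eq]
  conv_rhs => rw [← QuotientGroup.out_eq' t]
  exact (mk_eq_mk_iff_of_pow_eq_one hd).symm

theorem exists_lozSide_eq_iff (l : bradyComplex.Loz) (g : G) :
    (∃ i, (bradyComplex.lozSide l i).1 = g) ↔
      l = QuotientGroup.mk g ∨ l = QuotientGroup.mk (g * σ₃⁻¹) := by
  have hd : (δ ^ 2) ^ 2 = 1 := by rw [pow_two (δ ^ 2), delta_sq_mul_delta_sq]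
  have hσ₁ (k : G) : k * σ₁ * δ ^ 2 = k * δ ^ 2 * σ₃ := by
    rw [mul_assoc, mul_assoc, delta_sq_mul_σ₃]
  have hmk (k : G) : (k * σ₁ * δ ^ 2 = g ∨ k * σ₃ = g ∨ k * δ ^ 2 = g ∨ k = g) ↔
      (QuotientGroup.mk k : G ⧸ Subgroup.zpowers (δ ^ 2)) = QuotientGroup.mk g ∨
        (QuotientGroup.mk k : G ⧸ Subgroup.zpowers (δ ^ 2)) = QuotientGroup.mk (g * σ₃⁻¹) := by
    simp only [mk_eq_mk_iff_of_pow_eq_one hd, Fin.exists_fin_two, Fin.val_zero, Fin.val_one,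
      pow_zero, pow_one, mul_one, eq_mul_inv_iff_mul_eq, hσ₁]
    tauto
  conv_rhs => rw [← QuotientGroup.out_eq' l]
  refine Iff.trans ?_ (hmk (Quotient.out l))
  simp only [Fin.exists_fin_succ, Fin.exists_fin_zero, or_false]
  rfl

theorem start_mk (g : G) (b : Bool) :
    bradyComplex.start (g, b) = (QuotientGroup.mk (bif b then g else g * σ₁) : Vert) := by
  cases b <;> rfl

theorem start_mapEdge (g : G) (b : Bool) :
    complexV.start (edgeMap g, HamiltonianSurface.flip (edgeMap g) ^^ b) =
      vertMap (bradyComplex.start (g, b)) := by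
  refine (start_eq_origin _).trans ?_
  rw [start_mk, vertMap_mk, ← Bool.xor_assoc, Bool.xor_self, Bool.false_xor]
  cases b
  · rw [cond_false, cond_false, edgeMap_mul_σ₁]
  · rfl

theorem triSide_map (t : bradyComplex.Tri) (i : Fin 3) :
    triSide (edgeMap (Quotient.out t)).2
      ((triangleSymmetry (edgeMap (Quotient.out t)).1.num
        (HamiltonianSurface.flip (edgeMap (Quotient.out t)))).side i) =
    (edgeMap (bradyComplex.triSide t i).1,
      HamiltonianSurface.flip (edgeMap (bradyComplex.triSide t i).1) ^^
        (HamiltonianSurface.flip (edgeMap (Quotient.out t)) ^^ (bradyComplex.triSide t i).2)) := by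
  rw [side_triangleSymmetry, triSide_rotateTri, triSide_eq,
    edgeMap_mul_pow edgeMap_mul_σ₁_mul_δ]

theorem bradyLozSide_edgeMap (l : bradyComplex.Loz) (i : Fin 4) :
    bradyLozSide (edgeMap (Quotient.out l)) i =
      (edgeMap (bradyComplex.lozSide l i).1, (bradyComplex.lozSide l i).2) := by
  fin_cases i
  · exact congrArg (·, true) ((edgeMap_mul_δ_sq _).trans (by rw [edgeMap_mul_σ₁])).symm
  · exact congrArg (·, false) (edgeMap_mul_σ₃ _).symm
  · exact congrArg (·, false) (edgeMap_mul_δ_sq _).symm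
  · rfl

theorem lozSide_map (l : bradyComplex.Loz) (i : Fin 4) :
    Sum.elim lozSide fillSide (lozOf (edgeMap (Quotient.out l)))
      ((lozengeSymmetry (lozTurned (edgeMap (Quotient.out l)))
        (lozReflected (edgeMap (Quotient.out l)))).side i) =
    (edgeMap (bradyComplex.lozSide l i).1,
      HamiltonianSurface.flip (edgeMap (bradyComplex.lozSide l i).1) ^^
        (lozReflected (edgeMap (Quotient.out l)) ^^ (bradyComplex.lozSide l i).2)) := by
  rw [side_lozengeSymmetry, lozSide_lozOf, bradyLozSide_edgeMap]

/-- The covering of `V` by the Brady complex. -/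
noncomputable def covering : Hom bradyComplex complexV where
  vert := vertMap
  edge := edgeMap
  flip g := HamiltonianSurface.flip (edgeMap g)
  face
    | .tri t => .tri (edgeMap (Quotient.out t)).2
    | .loz l => .loz (lozOf (edgeMap (Quotient.out l)))
  iso
    | .tri t => triangleSymmetry (edgeMap (Quotient.out t)).1.num
        (HamiltonianSurface.flip (edgeMap (Quotient.out t)))
    | .loz l => lozengeSymmetry (lozTurned (edgeMap (Quotient.out l)))
        (lozReflected (edgeMap (Quotient.out l)))
  start_edge := start_mapEdge
  side_face
    | .tri t => triSide_map t
    | .loz l => lozSide_map l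

theorem covering_face_tri_mk (g : G) :
    covering.face (.tri (QuotientGroup.mk g : G ⧸ Subgroup.zpowers (σ₁ * δ))) =
      .tri (edgeMap g).2 := by
  refine congrArg Face.tri (apply_out_mk (u := fun g => (edgeMap g).2) (fun g => ?_) g)
  rw [edgeMap_mul_σ₁_mul_δ, rotateTri_snd]

theorem covering_face_loz_mk (g : G) :
    covering.face (.loz (QuotientGroup.mk g : G ⧸ Subgroup.zpowers (δ ^ 2))) =
      .loz (lozOf (edgeMap g)) := by
  refine congrArg Face.loz (apply_out_mk (u := fun g => lozOf (edgeMap g)) (fun g => ?_) g)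
  rw [edgeMap_mul_δ_sq, lozOf_actδ_actδ]

theorem existsUnique_edge_start {v : Vert} {e : HamiltonianSurface.Edge} {b : Bool}
    (h : origin (bif b then e else actσ₁ e) = vertMap v) :
    ∃! g : G, edgeMap g = e ∧ bradyComplex.start (g, b) = v := by
  simp only [start_mk]
  cases b
  · refine ((Equiv.mulRight σ₁).existsUnique_congr fun {g} => ?_).2 (existsUnique_edge h)
    rw [Equiv.coe_mulRight, edgeMap_mul_σ₁]
    exact and_congr_left' permσ₁.injective.eq_iff.symm
  · exact existsUnique_edge h

theorem existsUnique_mapSide {v : Vert} {s' : HamiltonianSurface.Edge × Bool}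
    (hs' : complexV.start s' = vertMap v) :
    ∃! s, covering.mapSide s = s' ∧ bradyComplex.start s = v := by
  obtain ⟨e, b⟩ := s'
  obtain ⟨g, ⟨rfl, hg⟩, hunique⟩ := existsUnique_edge_start ((start_eq_origin _).symm.trans hs')
  have hxor (c d : Bool) : (c ^^ (c ^^ d)) = d := by
    rw [← Bool.xor_assoc, Bool.xor_self, Bool.false_xor]
  refine ⟨(g, HamiltonianSurface.flip (edgeMap g) ^^ b), ⟨Prod.ext rfl (hxor _ _), hg⟩, ?_⟩
  rintro ⟨h, c⟩ ⟨hmap, hv⟩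
  have he : edgeMap h = edgeMap g := (Prod.mk.inj hmap).1
  have hb : (HamiltonianSurface.flip (edgeMap h) ^^ c) = b := (Prod.mk.inj hmap).2
  have hc : c = (HamiltonianSurface.flip (edgeMap g) ^^ b) := by rw [← he, ← hb, hxor]
  subst hc
  exact congrArg (·, _) (hunique h ⟨he, hv⟩)

theorem existsUnique_tri {g : G} {t' : Index} (ht' : ∃ i, (triSide t' i).1 = edgeMap g) :
    ∃! F, covering.face F = .tri t' ∧ ∃ i, (F.side i).1 = g := by
  rw [HamiltonianSurface.exists_triSide_eq_iff] at ht'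
  refine ⟨.tri (QuotientGroup.mk g : G ⧸ Subgroup.zpowers (σ₁ * δ)),
    ⟨(covering_face_tri_mk g).trans (congrArg _ ht'.symm), (exists_triSide_eq_iff _ g).2 rfl⟩, ?_⟩
  rintro (t | l) ⟨hF, hg⟩
  · rw [(exists_triSide_eq_iff t g).1 hg]
  · cases hF

theorem existsUnique_loz {g : G} {l' : Letter ⊕ Letter}
    (hl' : ∃ i, (Sum.elim lozSide fillSide l' i).1 = edgeMap g) :
    ∃! F, covering.face F = .loz l' ∧ ∃ i, (F.side i).1 = g := by
  have hg : edgeMap g = actσ₁ (edgeMap (g * σ₃⁻¹)) := by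
    rw [← edgeMap_mul_σ₃, inv_mul_cancel_right]
  have hne : lozOf (edgeMap g) ≠ lozOf (edgeMap (g * σ₃⁻¹)) := hg ▸ lozOf_actσ₁_ne _
  rw [hg, HamiltonianSurface.exists_lozSide_eq_iff, ← hg] at hl'
  suffices h : ∃! l : bradyComplex.Loz, covering.face (.loz l) = .loz l' ∧
      ∃ i, (bradyComplex.lozSide l i).1 = g by
    obtain ⟨l, hl, hunique⟩ := h
    refine ⟨.loz l, hl, ?_⟩
    rintro (t | m) hm
    · cases hm.1
    · exact congrArg _ (hunique m hm)
  simp only [exists_lozSide_eq_iff]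
  rcases hl' with rfl | rfl
  · refine ⟨_, ⟨covering_face_loz_mk g, .inl rfl⟩, ?_⟩
    rintro _ ⟨hm, rfl | rfl⟩
    · rfl
    · rw [covering_face_loz_mk] at hm
      exact absurd (Face.loz.inj hm).symm hne
  · refine ⟨_, ⟨covering_face_loz_mk (g * σ₃⁻¹), .inr rfl⟩, ?_⟩
    rintro _ ⟨hm, rfl | rfl⟩
    · rw [covering_face_loz_mk] at hm
      exact absurd (Face.loz.inj hm) hne
    · rfl

theorem isCovering_covering : covering.IsCovering := by
  refine Hom.isCovering_of_links ?_ edgeMap_surjective ?_ (fun _ _ => existsUnique_mapSide) ?_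
    face_side_injective
  · intro v
    obtain ⟨e, rfl⟩ := origin_surjective v
    obtain ⟨g, rfl⟩ := edgeMap_surjective e
    exact ⟨_, vertMap_mk g⟩
  · rintro (t | l)
    · obtain ⟨g, hg⟩ := edgeMap_surjective (.x, t)
      exact ⟨_, (covering_face_tri_mk g).trans (by rw [hg])⟩
    · obtain ⟨e, rfl⟩ := lozOf_surjective l
      obtain ⟨g, rfl⟩ := edgeMap_surjective e
      exact ⟨_, covering_face_loz_mk g⟩
  · rintro g (t' | l')
    · exact existsUnique_tri
    · exact existsUnique_loz

end Brady

theorem mainTheorem4 :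
    ∃ p : Brady.bradyComplex.Realization → HamiltonianSurface.complexV.Realization,
      IsUniversalCover p ∧ LozengeComplex.IsCellwiseIsometric p :=
  ⟨Brady.covering.realization,
    ⟨Brady.isCovering_covering.isCoveringMap_realization,
      Brady.isCovering_covering.surjective_realization, Brady.simplyConnectedSpace_bradyComplex⟩,
    Brady.covering.isCellwiseIsometric_realization⟩
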